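/- Let $\mathcal M$ be a von Neumann algebra equipped with a normal faithful finite trace $\tau$ with $\tau(1)=1$. For $1\le q<\infty$ let $L_q(\mathcal M)$ be the completion of $\mathcal M$ with respect to the norm $\|x\|_q=\tau(|x|^q)^{1/q}$, where $|x|=(x^*x)^{1/2}$. Let $(\mathcal M_n)_{n\ge 0}$ be an increasing sequence of von Neumann subalgebras of $\mathcal M$ and let $\mathcal E_n$ be the $\tau$-preserving conditional expectation of $\mathcal M$ onto $\mathcal M_n$, i.e. the unique linear map $\mathcal E_n:\mathcal M\to\mathcal M_n$ with $\mathcal E_n(axb)=a\,\mathcal E_n(x)\,b$ for $x\in\mathcal M$, $a,b\in\mathcal M_n$ and $\tau\circ\mathcal E_n=\tau$; its extension by continuity to $L_q(\mathcal M)$ is denoted by the same symbol. Then for every real number $q$ with $1\le q<\infty$ and every sequence $(x_n)_{n\ge 1}$ in $L_q(\mathcal M)$, $$\Big\|\Big(\sum_{n\ge 1}|\mathcal E_{n-1}(x_n)|^q\Big)^{1/q}\Big\|_q\;\le\;\Big\|\Big(\sum_{n\ge 1}|x_n|^q\Big)^{1/q}\Big\|_q .$$ Here $|x|^q\in L_1(\mathcal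 M)$ for $x\in L_q(\mathcal M)$ (by continuous extension of $x\mapsto|x|^q$ from $\mathcal M$), each side is a number in $[0,\infty]$, and a side is $\infty$ when its series $\sum_n|\cdot|^q$ does not converge in $L_1(\mathcal M)$; in particular, if $\sum_n|x_n|^q$ converges in $L_1(\mathcal M)$, then so does $\sum_n|\mathcal E_{n-1}(x_n)|^q$. -/

import Mathlib

/-! ## Von Neumann algebras as C*-algebras -/

section VonNeumann

variable {H : Type*} [NormedAddCommGroup H] [InnerProductSpace ℂ H] [CompleteSpace H]

instance VonNeumannAlgebra.instSMulMemClass : SMulMemClass (VonNeumannAlgebra H) ℂ (H →L[ℂ] H) where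
  smul_mem {S} c _ hx := S.toStarSubalgebra.smul_mem hx c

theorem VonNeumannAlgebra.isClosed_coe (M : VonNeumannAlgebra H) :
    IsClosed (M : Set (H →L[ℂ] H)) := by
  rw [← M.centralizer_centralizer]
  exact Set.isClosed_centralizer _

noncomputable instance VonNeumannAlgebra.instCStarAlgebra (M : VonNeumannAlgebra H) :
    CStarAlgebra M :=
  StarSubalgebra.cstarAlgebra M (h_closed := M.isClosed_coe)

/-- The order inherited from the order of bounded operators is the usual C*-algebra order. -/
instance VonNeumannAlgebra.instStarOrderedRing (M : VonNeumannAlgebra H) : StarOrderedRing M := by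
  refine StarOrderedRing.of_le_iff fun x y => ?_
  constructor
  · intro h
    have h' : (0 : H →L[ℂ] H) ≤ y - x := sub_nonneg.mpr h
    have hm : CFC.sqrt ((y : H →L[ℂ] H) - x) ∈ M := by
      rw [← SetLike.mem_coe, ← M.centralizer_centralizer]
      intro c hc
      have : Commute ((y : H →L[ℂ] H) - x) c := hc _ (y - x).2
      exact (this.cfcₙ_nnreal _).symm
    refine ⟨⟨_, hm⟩, ?_⟩
    apply Subtype.ext
    change (y : H →L[ℂ] H) = x + star (CFC.sqrt ((y : H →L[ℂ] H) - x)) * CFC.sqrt ((y : H →L[ℂ] H) - x)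
    rw [(CFC.sqrt_nonneg _).isSelfAdjoint.star_eq, CFC.sqrt_mul_sqrt_self _ h']; abel
  · rintro ⟨s, rfl⟩
    change (x : H →L[ℂ] H) ≤ x + star (s : H →L[ℂ] H) * s
    exact le_add_of_nonneg_right (star_mul_self_nonneg _)

end VonNeumann

section Trace

open scoped ComplexOrder

/-! ## Normal faithful tracial states and the norms of `L_q` -/

/-- A normal faithful finite trace `τ` with `τ 1 = 1` on a C*-algebra (below: on a von Neumann
algebra). Normality: `τ (sup D) = sup τ(D)` for every upward directed set `D` of positive elements
that has a supremum. -/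
structure NormalFaithfulTrace (A : Type*) [CStarAlgebra A] [PartialOrder A] [StarOrderedRing A]
    extends A →ₚ[ℂ] ℂ where
  trace_mul_comm' : ∀ x y : A, toPositiveLinearMap (x * y) = toPositiveLinearMap (y * x)
  map_one' : toPositiveLinearMap 1 = 1
  faithful' : ∀ x : A, toPositiveLinearMap (star x * x) = 0 → x = 0
  normal' : ∀ D : Set A, D.Nonempty → DirectedOn (· ≤ ·) D → (∀ a ∈ D, 0 ≤ a) →
    ∀ s : A, IsLUB D s → IsLUB ((fun a => (toPositiveLinearMap a).re) '' D) (toPositiveLinearMap s).re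

namespace NormalFaithfulTrace

variable {A : Type*} [CStarAlgebra A] [PartialOrder A] [StarOrderedRing A]

noncomputable instance : CoeFun (NormalFaithfulTrace A) (fun _ => A → ℂ) := ⟨fun τ => τ.toPositiveLinearMap⟩

variable (τ : NormalFaithfulTrace A)

lemma mul_comm_apply (x y : A) : τ (x * y) = τ (y * x) := τ.trace_mul_comm' x y

lemma re_nonneg {x : A} (hx : 0 ≤ x) : 0 ≤ (τ x).re :=
  (Complex.nonneg_iff.mp (map_nonneg τ.toPositiveLinearMap hx)).1

lemma eq_re {x : A} (hx : 0 ≤ x) : τ x = ((τ x).re : ℂ) :=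
  Complex.ext rfl (Complex.nonneg_iff.mp (map_nonneg τ.toPositiveLinearMap hx)).2.symm

lemma re_mono {x y : A} (h : x ≤ y) : (τ x).re ≤ (τ y).re :=
  (Complex.le_def.mp (OrderHomClass.mono τ.toPositiveLinearMap h)).1

lemma continuous : Continuous τ.toPositiveLinearMap := map_continuous τ.toPositiveLinearMap

lemma cauchySchwarz (x y : A) :
    ‖τ (star x * y)‖ ≤ √(τ (star x * x)).re * √(τ (star y * y)).re := by
  have := norm_inner_le_norm (𝕜 := ℂ) (τ.toPositiveLinearMap.toPreGNS x)
    (τ.toPositiveLinearMap.toPreGNS y)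
  rwa [PositiveLinearMap.preGNS_inner_def, PositiveLinearMap.preGNS_norm_def,
    PositiveLinearMap.preGNS_norm_def] at this

lemma norm_mul_le {h : A} (hh : 0 ≤ h) (y : A) : ‖τ (h * y)‖ ≤ (τ h).re * ‖y‖ := by
  set s := CFC.sqrt h with hs
  have hsa : star s = s := (CFC.sqrt_nonneg h).isSelfAdjoint.star_eq
  have hss : s * s = h := CFC.sqrt_mul_sqrt_self h
  have h1 := τ.cauchySchwarz s (s * y)
  have h2 : (τ (star (s * y) * (s * y))).re ≤ ‖y‖ ^ 2 * (τ h).re := by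
    have e : τ (star (s * y) * (s * y)) = τ (s * (y * star y) * star s) := by
      rw [mul_comm_apply, star_mul]; congr 1; noncomm_ring
    rw [e]
    have h3 := τ.re_mono (CStarAlgebra.star_right_conjugate_le_norm_smul (a := s)
      (b := y * star y))
    rw [hsa, hss, CStarRing.norm_self_mul_star, ← Complex.coe_smul, map_smul] at h3
    rw [hsa]
    simpa [sq] using h3
  rw [← mul_assoc, hsa, hss] at h1
  refine h1.trans ?_
  calc _ ≤ √(τ h).re * √(‖y‖ ^ 2 * (τ h).re) := by gcongr
    _ = _ := by
      rw [Real.sqrt_mul (by positivity), Real.sqrt_sq (by positivity), mul_left_comm,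
        Real.mul_self_sqrt (τ.re_nonneg hh), mul_comm]

open Complex Complex.HadamardThreeLines NormedSpace in
lemma exp_holder {S T : A} (hS : IsSelfAdjoint S) (hT : IsSelfAdjoint T) (c : A) (hc : ‖c‖ ≤ 1)
    {θ : ℝ} (h0 : 0 ≤ θ) (h1 : θ ≤ 1) :
    ‖τ (exp ((1 - θ) • S) * c * exp (θ • T))‖ ≤
      (τ (exp S)).re ^ (1 - θ) * (τ (exp T)).re ^ θ := by
  let +nondep : NormedAlgebra ℚ A := .restrictScalars ℚ ℂ A
  have hadd : ∀ (z w : ℂ) (L : A), exp ((z + w) • L) = exp (z • L) * exp (w • L) := fun z w L => by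
    rw [add_smul]
    exact exp_add_of_commute (((Commute.refl L).smul_left z).smul_right w)
  have hU : ∀ (t : ℝ) {L : A}, IsSelfAdjoint L → exp ((t * I : ℂ) • L) ∈ unitary A := by
    intro t L hL
    apply exp_mem_unitary_of_mem_skewAdjoint
    rw [skewAdjoint.mem_iff, star_smul, hL.star_eq]
    simp
  have hn : ∀ {U : A}, U ∈ unitary A → ‖U‖ ≤ 1 := by
    intro U hU
    rcases subsingleton_or_nontrivial A with h | h
    · rw [Subsingleton.elim U 0]; simp
    · exact (CStarRing.norm_of_mem_unitary hU).le
  have hd : ∀ L : A, Differentiable ℂ fun z : ℂ => exp (z • L) := fun L z =>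
    (hasDerivAt_exp_smul_const L z).differentiableAt
  have hb : ∀ {L : A}, IsSelfAdjoint L → ∃ C, ∀ z ∈ verticalClosedStrip 0 1, ‖exp (z • L)‖ ≤ C := by
    intro L hL
    obtain ⟨C, hC⟩ := (isCompact_Icc (a := (0 : ℝ)) (b := 1)).exists_bound_of_continuousOn
      (f := fun x : ℝ => exp ((x : ℂ) • L))
      ((hd L).continuous.comp continuous_ofReal).continuousOn
    refine ⟨C, fun z hz => ?_⟩
    rw [← re_add_im z, hadd]
    refine (norm_mul_le_of_le (hC z.re hz) (hn (hU z.im hL))).trans (by simp)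
  let τL : A →L[ℂ] ℂ := ⟨τ.toPositiveLinearMap.toLinearMap, τ.continuous⟩
  have hτL : ∀ x, τL x = τ x := fun _ => rfl
  let f : ℂ → ℂ := fun z => τL (exp ((1 - z) • S) * c * exp (z • T))
  have hf : Differentiable ℂ f := τL.differentiable.comp
    ((((hd S).comp ((differentiable_const 1).sub differentiable_id)).mul_const c).mul (hd T))
  have key := norm_le_interp_of_mem_verticalClosedStrip₀₁' f (z := θ)
    (a := (τ (exp S)).re) (b := (τ (exp T)).re) (by simp [verticalClosedStrip, h0, h1])
    hf.diffContOnCl ?_ ?_ ?_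
  · have e1 : ((1 : ℂ) - (θ : ℂ)) • S = (1 - θ : ℝ) • S := by
      rw [← Complex.coe_smul]; simp
    have e2 : (θ : ℂ) • T = θ • T := Complex.coe_smul _ _
    simpa only [f, e1, e2, hτL, ofReal_re] using key
  · obtain ⟨C, hC⟩ := hb hS
    obtain ⟨D, hD⟩ := hb hT
    refine ⟨‖τL‖ * (C * 1 * D), ?_⟩
    rintro _ ⟨z, hz, rfl⟩
    have hz' : 1 - z ∈ verticalClosedStrip 0 1 := by
      simp only [verticalClosedStrip, Set.mem_preimage, Set.mem_Icc, sub_re, one_re] at hz ⊢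
      constructor <;> linarith
    exact τL.le_opNorm_of_le (norm_mul_le_of_le (norm_mul_le_of_le (hC _ hz') hc) (hD _ hz))
  · intro z hz
    have hz : z = (z.im : ℂ) * I := by
      apply Complex.ext <;> simp; simpa using hz
    have e : 1 - z = 1 + ((-z.im : ℝ) : ℂ) * I := by rw [hz]; push_cast; simp; ring
    simp only [f, hτL]
    rw [e, hadd, one_smul, mul_assoc, mul_assoc]
    refine (τ.norm_mul_le hS.exp_nonneg _).trans
      (mul_le_of_le_one_right (τ.re_nonneg hS.exp_nonneg) ?_)
    rw [hz]
    have := norm_mul_le_of_le (hn (hU (-z.im) hS)) (norm_mul_le_of_le hc (hn (hU z.im hT)))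
    simpa using this
  · intro z hz
    have hz : z = 1 + (z.im : ℂ) * I := by
      apply Complex.ext <;> simp; simpa using hz
    have e : 1 - z = ((-z.im : ℝ) : ℂ) * I := by rw [hz]; push_cast; simp
    have e' : z = (z.im : ℂ) * I + 1 := by rw [add_comm]; exact hz
    simp only [f, hτL]
    rw [e, mul_comm_apply]
    rw [congrArg (fun w : ℂ => exp (w • T)) hz, hadd, one_smul, mul_assoc]
    refine (τ.norm_mul_le hT.exp_nonneg _).trans
      (mul_le_of_le_one_right (τ.re_nonneg hT.exp_nonneg) ?_)
    have := norm_mul_le_of_le (hn (hU z.im hT)) (norm_mul_le_of_le (hn (hU (-z.im) hS)) hc)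
    simpa using this


/-- The number `τ(|x| ^ q) ^ (1 / q)`. -/
noncomputable def lqNorm (q : ℝ) (x : A) : ℝ := (τ (CFC.abs x ^ q)).re ^ (1 / q)

lemma lqNorm_nonneg (q : ℝ) (x : A) : 0 ≤ τ.lqNorm q x :=
  Real.rpow_nonneg (τ.re_nonneg CFC.rpow_nonneg) _

lemma lqNorm_zero {q : ℝ} (hq : 1 ≤ q) : τ.lqNorm q 0 = 0 := by
  have h : CFC.rpow (0 : A) q = 0 := CFC.zero_rpow (by linarith)
  have h' : (0 : A) ^ q = 0 := h
  have hq' : q⁻¹ ≠ 0 := by positivity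
  simp [lqNorm, h', Real.zero_rpow hq']

lemma lqNorm_neg (q : ℝ) (x : A) : τ.lqNorm q (-x) = τ.lqNorm q x := by
  simp [lqNorm, CFC.abs_neg]

lemma spectrum_nonneg {h : A} (hh : 0 ≤ h) {t : ℝ} (ht : t ∈ spectrum ℝ h) : 0 ≤ t :=
  spectrum_nonneg_of_nonneg hh ht

lemma lqNorm_smul {q : ℝ} (hq : 1 ≤ q) (c : ℂ) (x : A) :
    τ.lqNorm q (c • x) = ‖c‖ * τ.lqNorm q x := by
  have hx : (0 : A) ≤ CFC.abs x := CFC.abs_nonneg x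
  have e : (‖c‖ • CFC.abs x) ^ q = (‖c‖ ^ q) • CFC.abs x ^ q := by
    rw [CFC.rpow_eq_cfc_real (a := ‖c‖ • CFC.abs x) (smul_nonneg (norm_nonneg c) hx),
      CFC.rpow_eq_cfc_real hx]
    have hc : ∀ s : Set ℝ, ContinuousOn (fun t : ℝ => t ^ q) s := fun s =>
      (Real.continuous_rpow_const (by linarith)).continuousOn
    rw [← cfc_smul_id (R := ℝ) ‖c‖ (CFC.abs x), ← cfc_comp' (fun t : ℝ => t ^ q) (‖c‖ • ·) _
      (hc _), ← cfc_smul (‖c‖ ^ q) (fun t : ℝ => t ^ q) _ (hc _)]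
    refine cfc_congr fun t ht => ?_
    simp [Real.mul_rpow (norm_nonneg c) (spectrum_nonneg hx ht)]
  unfold lqNorm
  rw [CFC.abs_smul, e, ← Complex.coe_smul, map_smul, smul_eq_mul, Complex.re_ofReal_mul,
    Real.mul_rpow (by positivity) (τ.re_nonneg CFC.rpow_nonneg), ← Real.rpow_mul (norm_nonneg c),
    mul_one_div_cancel (by linarith), Real.rpow_one]

lemma eq_zero_of_lqNorm_eq_zero {q : ℝ} (hq : 1 ≤ q) {x : A} (h : τ.lqNorm q x = 0) : x = 0 := by
  have hx : (0 : A) ≤ CFC.abs x := CFC.abs_nonneg x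
  have h1 : (τ (CFC.abs x ^ q)).re = 0 := by
    refine ((Real.rpow_eq_zero (τ.re_nonneg CFC.rpow_nonneg) ?_).mp h)
    have : 0 < q := by linarith
    positivity
  have h2 : CFC.abs x ^ q = 0 := by
    have hs := CFC.sqrt_mul_sqrt_self (CFC.abs x ^ q) CFC.rpow_nonneg
    have hsa : star (CFC.sqrt (CFC.abs x ^ q)) = CFC.sqrt (CFC.abs x ^ q) :=
      (CFC.sqrt_nonneg _).isSelfAdjoint.star_eq
    have := τ.faithful' (CFC.sqrt (CFC.abs x ^ q)) (by
      rw [hsa, hs, τ.eq_re CFC.rpow_nonneg, h1, Complex.ofReal_zero])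
    rw [← hs, this, mul_zero]
  have h3 := CFC.rpow_rpow_of_exponent_nonneg (CFC.abs x) q q⁻¹ (by linarith)
    (inv_nonneg.mpr (by linarith)) hx
  have h4 : CFC.rpow (0 : A) q⁻¹ = 0 := CFC.zero_rpow (inv_ne_zero (by linarith))
  rw [h2, mul_inv_cancel₀ (by linarith), CFC.rpow_one _ hx] at h3
  exact CFC.abs_eq_zero_iff.mp (h3.symm.trans h4)

/-- The element `(|x| + ε) ^ s`. -/
noncomputable def shift (x : A) (ε s : ℝ) : A := cfc (fun t : ℝ => (t + ε) ^ s) (CFC.abs x)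

lemma continuousOn_shift (x : A) {ε : ℝ} (hε : 0 < ε) (s : ℝ) :
    ContinuousOn (fun t : ℝ => (t + ε) ^ s) (spectrum ℝ (CFC.abs x)) := by
  refine ContinuousOn.rpow_const (by fun_prop) fun t ht => Or.inl ?_
  have := spectrum_nonneg (CFC.abs_nonneg x) ht
  positivity

lemma shift_eq_exp (x : A) {ε : ℝ} (hε : 0 < ε) (s : ℝ) :
    shift x ε s = NormedSpace.exp
      (s • cfc (fun t : ℝ => Real.log (t + ε)) (CFC.abs x)) := by
  have hl : ContinuousOn (fun t : ℝ => Real.log (t + ε)) (spectrum ℝ (CFC.abs x)) := by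
    refine ContinuousOn.log (by fun_prop) fun t ht => ?_
    have := spectrum_nonneg (CFC.abs_nonneg x) ht
    positivity
  rw [← cfc_smul s _ _ hl, ← CFC.real_exp_eq_normedSpace_exp (cfc_predicate _ _),
    ← cfc_comp' Real.exp _ _ (by fun_prop) (by simp only [smul_eq_mul]; exact continuousOn_const.mul hl)]
  refine cfc_congr fun t ht => ?_
  have := spectrum_nonneg (CFC.abs_nonneg x) ht
  simp [Real.rpow_def_of_pos (show 0 < t + ε by positivity), mul_comm]

lemma shift_mul_shift (x : A) {ε : ℝ} (hε : 0 < ε) (s r : ℝ) :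
    shift x ε s * shift x ε r = shift x ε (s + r) := by
  unfold shift
  rw [← cfc_mul _ _ _ (continuousOn_shift x hε s) (continuousOn_shift x hε r)]
  refine cfc_congr fun t ht => ?_
  have := spectrum_nonneg (CFC.abs_nonneg x) ht
  exact (Real.rpow_add (by positivity) _ _).symm

lemma shift_zero (x : A) (ε : ℝ) : shift x ε 0 = 1 := by
  simp [shift, cfc_const_one ℝ (CFC.abs x)]

lemma shift_nonneg (x : A) {ε : ℝ} (hε : 0 < ε) (s : ℝ) : 0 ≤ shift x ε s :=
  cfc_nonneg fun t ht => by
    have := spectrum_nonneg (CFC.abs_nonneg x) ht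
    positivity

lemma star_shift (x : A) (ε s : ℝ) : star (shift x ε s) = shift x ε s :=
  (cfc_predicate (R := ℝ) _ _ : IsSelfAdjoint (shift x ε s)).star_eq

lemma shift_star_mul_self (x : A) {ε : ℝ} (hε : 0 < ε) (s r : ℝ) :
    shift x ε s * (star x * x) * shift x ε r =
      cfc (fun t : ℝ => t ^ 2 * (t + ε) ^ (s + r)) (CFC.abs x) := by
  have e : star x * x = cfc (fun t : ℝ => t ^ 2) (CFC.abs x) := by
    rw [cfc_pow_id (R := ℝ) _ 2, CFC.abs_sq]
  rw [e]
  unfold shift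
  rw [← cfc_mul _ _ _ (continuousOn_shift x hε s) (by fun_prop),
    ← cfc_mul (fun t : ℝ => (t + ε) ^ s * t ^ 2) _ _
      ((continuousOn_shift x hε s).mul (by fun_prop)) (continuousOn_shift x hε r)]
  refine cfc_congr fun t ht => ?_
  have := spectrum_nonneg (CFC.abs_nonneg x) ht
  rw [Real.rpow_add (by positivity)]; ring

lemma norm_mul_shift_le (x : A) {ε : ℝ} (hε : 0 < ε) : ‖x * shift x ε (-1)‖ ≤ 1 := by
  have h : ‖x * shift x ε (-1)‖ * ‖x * shift x ε (-1)‖ ≤ 1 := by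
    rw [← CStarRing.norm_star_mul_self, star_mul, star_shift,
      show shift x ε (-1) * star x * (x * shift x ε (-1)) =
        shift x ε (-1) * (star x * x) * shift x ε (-1) by noncomm_ring,
      shift_star_mul_self x hε]
    refine norm_cfc_le zero_le_one fun t ht => ?_
    have ht := spectrum_nonneg (CFC.abs_nonneg x) ht
    have e : (t + ε) ^ (-1 + -1 : ℝ) = ((t + ε) ^ 2)⁻¹ := by
      rw [show (-1 + -1 : ℝ) = -(2 : ℕ) by norm_num, Real.rpow_neg (by positivity),
        Real.rpow_natCast]
    rw [e, Real.norm_of_nonneg (by positivity)]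
    exact mul_inv_le_one_of_le₀ (by gcongr; linarith) (by positivity)
  nlinarith [norm_nonneg (x * shift x ε (-1))]

lemma shift_holder {q : ℝ} (hq : 1 ≤ q) (x z : A) {ε : ℝ} (hε : 0 < ε) :
    ‖τ (shift z ε (q - 2) * star z * x)‖ ≤
      (τ (shift z ε q)).re ^ (1 - 1 / q) * (τ (shift x ε q)).re ^ (1 / q) := by
  have hq0 : 0 < q := by linarith
  set S := q • cfc (fun t : ℝ => Real.log (t + ε)) (CFC.abs z) with hS
  set T := q • cfc (fun t : ℝ => Real.log (t + ε)) (CFC.abs x) with hT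
  have hSa : IsSelfAdjoint S := IsSelfAdjoint.smul (IsSelfAdjoint.all q) (cfc_predicate _ _)
  have hTa : IsSelfAdjoint T := IsSelfAdjoint.smul (IsSelfAdjoint.all q) (cfc_predicate _ _)
  set c := star (z * shift z ε (-1)) * (x * shift x ε (-1)) with hc
  have hc1 : ‖c‖ ≤ 1 := by
    have := norm_mul_le_of_le ((norm_star _).trans_le (norm_mul_shift_le z hε))
      (norm_mul_shift_le x hε)
    rwa [mul_one] at this
  have h := τ.exp_holder hSa hTa c hc1 (θ := 1 / q) (by positivity)
    ((div_le_one hq0).mpr hq)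
  have e1 : (1 - 1 / q) • S = (q - 1) • cfc (fun t : ℝ => Real.log (t + ε)) (CFC.abs z) := by
    rw [hS, smul_smul]; congr 1; field_simp
  have e2 : (1 / q) • T = (1 : ℝ) • cfc (fun t : ℝ => Real.log (t + ε)) (CFC.abs x) := by
    rw [hT, smul_smul]; congr 1; field_simp
  rw [e1, e2, ← shift_eq_exp z hε, ← shift_eq_exp x hε, ← shift_eq_exp z hε,
    ← shift_eq_exp x hε] at h
  refine le_trans (le_of_eq ?_) h
  congr 2
  rw [hc, star_mul, star_shift]
  calc _ = shift z ε (q - 1 + -1) * star z * x * shift x ε (-1 + 1) := by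
        rw [show (-1 + 1 : ℝ) = 0 by ring, shift_zero, mul_one,
          show q - 1 + -1 = q - 2 by ring]
    _ = _ := by
      rw [← shift_mul_shift z hε, ← shift_mul_shift x hε]; noncomm_ring

lemma shift_lower {q : ℝ} (hq : 1 ≤ q) (z : A) {ε : ℝ} (hε : 0 < ε) (hε1 : ε ≤ 1) :
    (τ (shift z ε q)).re - 2 * ε * (‖z‖ + 1) ^ (q - 1) ≤
      (τ (shift z ε (q - 2) * star z * z)).re := by
  have e : shift z ε (q - 2) * star z * z =
      cfc (fun t : ℝ => t ^ 2 * (t + ε) ^ (q - 2 + 0)) (CFC.abs z) := by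
    rw [← shift_star_mul_self z hε, shift_zero, mul_one, mul_assoc]
  have hcont : ContinuousOn (fun t : ℝ => t ^ 2 * (t + ε) ^ (q - 2 + 0))
      (spectrum ℝ (CFC.abs z)) := ContinuousOn.mul (by fun_prop) (continuousOn_shift z hε _)
  have h : shift z ε q - algebraMap ℝ A (2 * ε * (‖z‖ + 1) ^ (q - 1)) ≤
      shift z ε (q - 2) * star z * z := by
    rw [e, shift, ← cfc_const (2 * ε * (‖z‖ + 1) ^ (q - 1)) (CFC.abs z),
      ← cfc_sub _ _ _ (continuousOn_shift z hε q) (by fun_prop)]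
    refine cfc_mono (fun t ht => ?_) ((continuousOn_shift z hε q).sub (by fun_prop)) hcont
    have ht0 := spectrum_nonneg (CFC.abs_nonneg z) ht
    have ht1 : t ≤ ‖z‖ := by
      have : Nontrivial A := by
        by_contra hA
        rw [not_nontrivial_iff_subsingleton] at hA
        simp [spectrum.of_subsingleton] at ht
      have := spectrum.norm_le_norm_of_mem ht
      rw [Real.norm_of_nonneg ht0, CFC.norm_abs] at this
      exact this
    have hp : 0 < t + ε := by positivity
    have e1 : (t + ε) ^ q = (t + ε) ^ 2 * (t + ε) ^ (q - 2) := by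
      rw [← Real.rpow_natCast, ← Real.rpow_add hp]; congr 1; push_cast; ring
    have e2 : (t + ε) ^ (q - 1) = (t + ε) * (t + ε) ^ (q - 2) := by
      nth_rw 2 [← Real.rpow_one (t + ε)]
      rw [← Real.rpow_add hp]; congr 1; ring
    have h3 : (t + ε) ^ (q - 1) ≤ (‖z‖ + 1) ^ (q - 1) :=
      Real.rpow_le_rpow hp.le (by linarith) (by linarith)
    have h4 : 0 < (t + ε) ^ (q - 2) := by positivity
    rw [add_zero]
    have h5 : 2 * ε * (t + ε) ^ (q - 1) ≤ 2 * ε * (‖z‖ + 1) ^ (q - 1) := by gcongr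
    rw [e2] at h5
    rw [e1]
    nlinarith [mul_pos h4 (mul_pos hε hε)]
  have := τ.re_mono h
  rw [map_sub, Algebra.algebraMap_eq_smul_one, ← Complex.coe_smul, map_smul, τ.map_one'] at this
  simpa using this

lemma tendsto_shift {q : ℝ} (hq : 1 ≤ q) (x : A) :
    Filter.Tendsto (fun ε : ℝ => (τ (shift x ε q)).re) (nhdsWithin 0 (Set.Ioi 0))
      (nhds (τ (CFC.abs x ^ q)).re) := by
  have hF : Continuous fun p : ℝ × ℝ => (p.2 + p.1) ^ q :=
    (Real.continuous_rpow_const (by linarith)).comp (continuous_snd.add continuous_fst)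
  have h1 : Filter.Tendsto (fun ε : ℝ => shift x ε q) (nhdsWithin 0 (Set.Ioi 0))
      (nhds (CFC.abs x ^ q)) := by
    rw [CFC.rpow_eq_cfc_real (CFC.abs_nonneg x)]
    refine tendsto_cfc_fun ?_ ?_
    · have : TendstoUniformlyOn (fun (ε t : ℝ) => (t + ε) ^ q) (fun t => (t + 0) ^ q)
          (nhdsWithin 0 (Set.Icc 0 1)) (spectrum ℝ (CFC.abs x)) := by
        refine UniformContinuousOn.tendstoUniformlyOn (F := fun (ε t : ℝ) => (t + ε) ^ q) ?_
          (Set.left_mem_Icc.mpr zero_le_one)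
        exact (isCompact_Icc.prod (ContinuousFunctionalCalculus.isCompact_spectrum _)).uniformContinuousOn_of_continuous
          hF.continuousOn
      have hle : nhdsWithin (0 : ℝ) (Set.Ioi 0) ≤ nhdsWithin 0 (Set.Icc 0 1) := by
        rw [← nhdsWithin_Ioc_eq_nhdsGT (zero_lt_one' ℝ)]
        exact nhdsWithin_mono _ Set.Ioc_subset_Icc_self
      simp only [add_zero] at this
      exact fun u hu => hle (this u hu)
    · filter_upwards [self_mem_nhdsWithin] with ε hε
      exact continuousOn_shift x hε q
  exact (Complex.continuous_re.comp τ.continuous).continuousAt.tendsto.comp h1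

lemma lqNorm_add_le {q : ℝ} (hq : 1 ≤ q) (x y : A) :
    τ.lqNorm q (x + y) ≤ τ.lqNorm q x + τ.lqNorm q y := by
  have hq0 : 0 < q := by linarith
  set z := x + y with hz
  set Z := (τ (CFC.abs z ^ q)).re with hZ
  have hZ0 : 0 ≤ Z := τ.re_nonneg CFC.rpow_nonneg
  have key : Z ≤ Z ^ (1 - 1 / q) * (τ.lqNorm q x + τ.lqNorm q y) := by
    have hθ : 0 ≤ 1 - 1 / q := by rw [sub_nonneg, div_le_one hq0]; exact hq
    have hl : Filter.Tendsto (fun ε : ℝ => (τ (shift z ε q)).re -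
        2 * ε * (‖z‖ + 1) ^ (q - 1)) (nhdsWithin 0 (Set.Ioi 0)) (nhds Z) := by
      have h2 : Filter.Tendsto (fun ε : ℝ => 2 * ε * (‖z‖ + 1) ^ (q - 1))
          (nhdsWithin 0 (Set.Ioi 0)) (nhds (2 * 0 * (‖z‖ + 1) ^ (q - 1))) :=
        Filter.Tendsto.mono_left (Continuous.tendsto (by fun_prop) _) nhdsWithin_le_nhds
      simpa using (τ.tendsto_shift hq z).sub h2
    have hr := ((τ.tendsto_shift hq z).rpow_const (p := 1 - 1 / q) (Or.inr hθ)).mul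
      (((τ.tendsto_shift hq x).rpow_const (p := 1 / q) (Or.inr (by positivity))).add
      ((τ.tendsto_shift hq y).rpow_const (p := 1 / q) (Or.inr (by positivity))))
    refine le_of_tendsto_of_tendsto hl hr ?_
    filter_upwards [Ioc_mem_nhdsGT (show (0 : ℝ) < 1 by norm_num)] with ε hε
    have h1 := τ.shift_lower hq z hε.1 hε.2
    have h2 := τ.shift_holder hq x z hε.1
    have h3 := τ.shift_holder hq y z hε.1
    have e : τ (shift z ε (q - 2) * star z * z) =
        τ (shift z ε (q - 2) * star z * x) + τ (shift z ε (q - 2) * star z * y) := by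
      rw [← map_add, ← mul_add]
    rw [e, Complex.add_re] at h1
    rw [mul_add]
    exact h1.trans (add_le_add ((Complex.re_le_norm _).trans h2)
      ((Complex.re_le_norm _).trans h3))
  rcases hZ0.eq_or_lt with h | h
  · have : τ.lqNorm q z = 0 := by
      rw [lqNorm, ← hZ, ← h, Real.zero_rpow (by positivity)]
    rw [this]
    exact add_nonneg (τ.lqNorm_nonneg q x) (τ.lqNorm_nonneg q y)
  · have e : Z = Z ^ (1 - 1 / q) * Z ^ (1 / q) := by
      rw [← Real.rpow_add h]; simp
    nth_rw 1 [e] at key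
    exact le_of_mul_le_mul_left key (Real.rpow_pos_of_pos h _)

/-! ## The spaces `L_q` -/

/-- The algebra `A`, as a type synonym that carries the norm `‖x‖_q = τ(|x| ^ q) ^ (1 / q)`. -/
@[nolint unusedArguments]
def PreLq (_τ : NormalFaithfulTrace A) (_q : ℝ) : Type _ := A

noncomputable instance (q : ℝ) : AddCommGroup (τ.PreLq q) := inferInstanceAs (AddCommGroup A)

noncomputable instance (q : ℝ) : Module ℂ (τ.PreLq q) := inferInstanceAs (Module ℂ A)

/-- The identity from the algebra to its synonym with the `q`-norm. -/
noncomputable def toPreLq (q : ℝ) : A ≃ₗ[ℂ] τ.PreLq q := LinearEquiv.refl ℂ A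

/-- The identity from the synonym with the `q`-norm back to the algebra. -/
noncomputable def ofPreLq {q : ℝ} : τ.PreLq q ≃ₗ[ℂ] A := (τ.toPreLq q).symm

noncomputable instance (q : ℝ) : Norm (τ.PreLq q) := ⟨fun a => τ.lqNorm q (τ.ofPreLq a)⟩

variable {τ} in
lemma preLq_norm_def {q : ℝ} (a : τ.PreLq q) : ‖a‖ = τ.lqNorm q (τ.ofPreLq a) := rfl

lemma preLq_normedSpaceCore (q : ℝ) [hq : Fact (1 ≤ q)] :
    NormedSpace.Core ℂ (τ.PreLq q) where
  norm_nonneg x := τ.lqNorm_nonneg q x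
  norm_smul c x := τ.lqNorm_smul hq.out c x
  norm_triangle x y := τ.lqNorm_add_le hq.out x y
  norm_eq_zero_iff _ :=
    ⟨fun h => τ.eq_zero_of_lqNorm_eq_zero hq.out h, fun h => h ▸ τ.lqNorm_zero hq.out⟩

noncomputable instance (q : ℝ) [Fact (1 ≤ q)] : NormedAddCommGroup (τ.PreLq q) :=
  NormedAddCommGroup.ofCore (τ.preLq_normedSpaceCore q)

noncomputable instance (q : ℝ) [Fact (1 ≤ q)] : NormedSpace ℂ (τ.PreLq q) :=
  NormedSpace.ofCore (τ.preLq_normedSpaceCore q)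

/-- The Banach space `L_q`: the completion of the algebra for the norm `τ(|x| ^ q) ^ (1 / q)`. -/
abbrev Lq (q : ℝ) [Fact (1 ≤ q)] : Type _ := UniformSpace.Completion (τ.PreLq q)

instance : Fact ((1 : ℝ) ≤ 1) := ⟨le_rfl⟩

/-- The extension by continuity to `L_p → L_r` of a map `f` of the algebra into itself: its value
at `x` is the limit in `L_r` of `f a` as `a`, in the algebra, tends to `x` in `L_p`. -/
noncomputable def extendLq (p r : ℝ) [Fact (1 ≤ p)] [Fact (1 ≤ r)] (f : A → A) :
    τ.Lq p → τ.Lq r :=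
  (UniformSpace.Completion.isDenseInducing_coe (α := τ.PreLq p)).extend
    fun a => ((τ.toPreLq r (f (τ.ofPreLq a)) : τ.PreLq r) : τ.Lq r)

/-- The map `x ↦ |x| ^ (p / r)` from `L_p` to `L_r`: the extension by continuity of this map of the
algebra, which is continuous from the `p`-norm to the `r`-norm. -/
noncomputable def absRpow (p r : ℝ) [Fact (1 ≤ p)] [Fact (1 ≤ r)] : τ.Lq p → τ.Lq r :=
  τ.extendLq p r fun a => CFC.abs a ^ (p / r)

open Classical in
/-- The number `‖(∑ |x i| ^ q) ^ (1 / q)‖_q` in `[0, ∞]`. The elements `|x i| ^ q` are in `L_1`; if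
their series converges there, its sum `S` is a positive element of `L_1`, so that
`S ^ (1 / q) = |S| ^ (1 / q)` is in `L_q`, and the value is the norm of this element; if not, the
value is `∞`. -/
noncomputable def lqSumNorm (q : ℝ) [Fact (1 ≤ q)] {ι : Type*} (x : ι → τ.Lq q) : ENNReal :=
  if Summable fun i => τ.absRpow q 1 (x i) then
    ‖τ.absRpow 1 q (∑' i, τ.absRpow q 1 (x i))‖ₑ
  else ⊤

end NormalFaithfulTrace

/-! ## Conditional expectations -/

namespace NormalFaithfulTrace

variable {H : Type*} [NormedAddCommGroup H] [InnerProductSpace ℂ H] [CompleteSpace H]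
  {M : VonNeumannAlgebra H} (τ : NormalFaithfulTrace M)

/-- `E` is the trace-preserving conditional expectation of `M` onto its von Neumann subalgebra
`N`. -/
structure IsCondExp (N : VonNeumannAlgebra H) (E : M →ₗ[ℂ] M) : Prop where
  mem : ∀ x : M, (E x : H →L[ℂ] H) ∈ N
  bimodule : ∀ a b x : M, (a : H →L[ℂ] H) ∈ N → (b : H →L[ℂ] H) ∈ N → E (a * x * b) = a * E x * b
  trace : ∀ x : M, τ (E x) = τ x

/-- The conditional expectation is unique. -/
theorem IsCondExp.unique {N : VonNeumannAlgebra H} {E F : M →ₗ[ℂ] M}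
    (hE : τ.IsCondExp N E) (hF : τ.IsCondExp N F) : E = F := by
  ext1 x
  set d : M := E x - F x with hd
  have hdN : ((star d : M) : H →L[ℂ] H) ∈ N := star_mem (sub_mem (hE.mem x) (hF.mem x))
  have h1 : ((1 : M) : H →L[ℂ] H) ∈ N := one_mem N
  have hE' := hE.bimodule (star d) 1 x hdN h1
  have hF' := hF.bimodule (star d) 1 x hdN h1
  rw [mul_one, mul_one] at hE' hF'
  have : d = 0 := τ.faithful' d (by
    change τ (star d * d) = 0
    rw [hd, mul_sub, map_sub, ← hd, ← hE', ← hF', hE.trace, hF.trace, sub_self])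
  exact sub_eq_zero.mp this

open Classical in
/-- The conditional expectation of `M` onto `N`. -/
noncomputable def condExp (N : VonNeumannAlgebra H) : M →ₗ[ℂ] M :=
  if h : ∃ E : M →ₗ[ℂ] M, τ.IsCondExp N E then h.choose else 0

/-- The extension by continuity of the conditional expectation to `L_q(M)`. Its range is the closure
`L_q(N)` of `N` in `L_q(M)`. -/
noncomputable def condExpLq (N : VonNeumannAlgebra H) (q : ℝ) [Fact (1 ≤ q)] :
    τ.Lq q → τ.Lq q :=
  τ.extendLq q q (τ.condExp N)

end NormalFaithfulTrace

end Trace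

/-! The trace reduces the inequality to scalars. For `x` in L_q, the element |x|^q of L_1 has trace
and norm both equal to ‖x‖_q^q, and the trace is contractive on L_1. Hence ∑|x_n|^q converges in L_1
exactly when ∑‖x_n‖_q^q converges (`summable_absRpow_iff`), the norm of its sum is that number
(`norm_tsum_absRpow`), and a finite side of the inequality is (∑‖·‖_q^q)^(1/q). It is therefore
enough that each conditional expectation contracts L_q.

Contractivity is duality inside the subalgebra. For z = E x the element c = (|z|+ε)^(q-2) z⋆ lies in
N, so τ(cz) = τ(cx). As ε → 0 the left side recovers ‖z‖_q^q, while Hölder bounds the right side by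
‖z‖_q^(q-1) ‖x‖_q (`lqNorm_le_of_trace_eq`, `IsCondExp.lqNorm_le`).

Two definitions carry default values that must be excluded. `extendLq` is a limit only where one
exists, so a ↦ |a|^(p/r) must respect Cauchy filters; this comes from approximating it by
polynomials in the resolvent (1+|a|²)⁻¹, which are Lipschitz in `a`
(`exists_lqNorm_abs_rpow_sub_lt`). And `condExp` is zero unless an expectation exists. The
expectation is the 2-norm orthogonal projection onto N; the difficulty is that the projection of an
operator is a priori only a vector of the GNS completion. Approximate projections are truncated to
the unit ball, and the unit ball is complete for the 2-norm (`exists_tendsto_of_l2Norm_sub_le`). -/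

namespace NormalFaithfulTrace

open scoped ComplexOrder

/-! ### The q-norms on the algebra: adjoints, multiplication, comparison of exponents. -/

section Ideal

variable {A : Type*} [CStarAlgebra A] [PartialOrder A] [StarOrderedRing A]
  (τ : NormalFaithfulTrace A)

lemma norm_apply_le (x : A) : ‖τ x‖ ≤ ‖x‖ := by
  have h := τ.norm_mul_le (zero_le_one (α := A)) x
  rwa [one_mul, τ.map_one', Complex.one_re, one_mul] at h

lemma apply_star_mul_aeval (x : A) (P : Polynomial ℝ) :
    τ (Polynomial.aeval (x * star x) P) = τ (Polynomial.aeval (star x * x) P) := by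
  have hpow : ∀ n : ℕ, x * (star x * x) ^ n = (x * star x) ^ n * x := fun n => by
    induction n with
    | zero => simp
    | succ n ih => rw [pow_succ, ← mul_assoc, ih, pow_succ]; noncomm_ring
  induction P using Polynomial.induction_on' with
  | add p r hp hr => simp only [map_add, hp, hr]
  | monomial n c =>
    rw [Polynomial.aeval_monomial, Polynomial.aeval_monomial, Algebra.algebraMap_eq_smul_one,
      ← Complex.coe_smul, smul_mul_assoc, smul_mul_assoc, one_mul, one_mul, map_smul, map_smul]
    congr 1
    cases n with
    | zero => simp
    | succ n => rw [pow_succ, ← mul_assoc, ← hpow, mul_assoc, mul_comm_apply, mul_assoc, pow_succ]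

/-- Traciality gives equality for monomials, and Weierstrass approximation on [0, ‖x‖²], an interval
containing both spectra, does the rest. With powers for `f` this yields ‖x⋆‖_q = ‖x‖_q. -/
lemma apply_cfc_mul_star (x : A) {f : ℝ → ℝ} (hf : Continuous f) :
    τ (cfc f (x * star x)) = τ (cfc f (star x * x)) := by
  rcases subsingleton_or_nontrivial A with h | h
  · rw [Subsingleton.elim (cfc f (x * star x)) (cfc f (star x * x))]
  refine eq_of_forall_dist_le fun ε hε => ?_
  obtain ⟨P, hP⟩ := exists_polynomial_near_of_continuousOn 0 (‖x‖ * ‖x‖) f hf.continuousOn (ε / 2)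
    (by positivity)
  have key : ∀ b : A, 0 ≤ b → ‖b‖ ≤ ‖x‖ * ‖x‖ → dist (τ (cfc f b)) (τ (Polynomial.aeval b P)) ≤ ε / 2 := by
    intro b hb hbn
    rw [dist_eq_norm, ← map_sub, ← cfc_polynomial P b, ← cfc_sub _ _ _ hf.continuousOn]
    refine (τ.norm_apply_le _).trans (norm_cfc_le (by positivity) fun t ht => ?_)
    have h1 := spectrum.norm_le_norm_of_mem ht
    have h0 := spectrum_nonneg hb ht
    rw [Real.norm_of_nonneg h0] at h1
    rw [norm_sub_rev]
    exact (hP t ⟨h0, h1.trans hbn⟩).le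
  have h1 := key _ (mul_star_self_nonneg x) (by rw [CStarRing.norm_self_mul_star])
  have h2 := key _ (star_mul_self_nonneg x) (by rw [CStarRing.norm_star_mul_self])
  rw [apply_star_mul_aeval] at h1
  calc _ ≤ ε / 2 + ε / 2 := (dist_triangle_right _ _ _).trans (add_le_add h1 h2)
    _ = ε := by ring

lemma abs_rpow_eq_cfc_star_mul_self {q : ℝ} (hq : 0 ≤ q) (x : A) :
    CFC.abs x ^ q = cfc (fun t : ℝ => t ^ (q / 2)) (star x * x) := by
  have hc : ∀ s : Set ℝ, ContinuousOn (fun t : ℝ => t ^ (q / 2)) s := fun s =>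
    (Real.continuous_rpow_const (by positivity)).continuousOn
  rw [CFC.rpow_eq_cfc_real (CFC.abs_nonneg x), ← CFC.abs_sq, ← cfc_pow_id (R := ℝ) (CFC.abs x) 2,
    ← cfc_comp' (fun t : ℝ => t ^ (q / 2)) (fun t => t ^ 2) _ (hc _)]
  refine cfc_congr fun t ht => ?_
  have := spectrum_nonneg (CFC.abs_nonneg x) ht
  change t ^ q = (t ^ 2) ^ (q / 2)
  rw [← Real.rpow_natCast, ← Real.rpow_mul this]
  congr 1; push_cast; ring

lemma lqNorm_star {q : ℝ} (hq : 0 ≤ q) (x : A) : τ.lqNorm q (star x) = τ.lqNorm q x := by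
  unfold lqNorm
  rw [abs_rpow_eq_cfc_star_mul_self hq, abs_rpow_eq_cfc_star_mul_self hq, star_star,
    τ.apply_cfc_mul_star x (Real.continuous_rpow_const (by positivity))]

lemma lqNorm_unitary_mul (q : ℝ) (u : unitary A) (x : A) :
    τ.lqNorm q (u * x) = τ.lqNorm q x := by
  have : star (u * x : A) * (u * x) = star x * x := by
    rw [star_mul, mul_assoc, ← mul_assoc (star (u : A)), Unitary.coe_star_mul_self, one_mul]
  unfold lqNorm CFC.abs
  rw [this]

/-- A combination of four unitaries with coefficients at most ‖c‖/2 represents `c`, and left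
multiplication by a unitary does not change |x|. The factor 2 = 4 · 1/2 is not optimal, but
continuity estimates do not need better. -/
lemma lqNorm_mul_le_left {q : ℝ} (hq : 1 ≤ q) (c x : A) :
    τ.lqNorm q (c * x) ≤ 2 * ‖c‖ * τ.lqNorm q x := by
  obtain ⟨u, k, hc, hk⟩ := CStarAlgebra.exists_sum_four_unitary c
  have h : ∀ i, τ.lqNorm q (k i • (u i : A) * x) ≤ ‖c‖ / 2 * τ.lqNorm q x := fun i => by
    rw [smul_mul_assoc, τ.lqNorm_smul hq, lqNorm_unitary_mul]
    exact mul_le_mul_of_nonneg_right (hk i) (τ.lqNorm_nonneg q x)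
  have e : c * x = k 0 • (u 0 : A) * x + k 1 • (u 1 : A) * x + k 2 • (u 2 : A) * x +
      k 3 • (u 3 : A) * x := by
    nth_rw 1 [hc]
    rw [Fin.sum_univ_four, add_mul, add_mul, add_mul]
  have h1 := τ.lqNorm_add_le hq (k 0 • (u 0 : A) * x + k 1 • (u 1 : A) * x + k 2 • (u 2 : A) * x)
    (k 3 • (u 3 : A) * x)
  have h2 := τ.lqNorm_add_le hq (k 0 • (u 0 : A) * x + k 1 • (u 1 : A) * x) (k 2 • (u 2 : A) * x)
  have h3 := τ.lqNorm_add_le hq (k 0 • (u 0 : A) * x) (k 1 • (u 1 : A) * x)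
  rw [e]
  linarith [h 0, h 1, h 2, h 3]

lemma lqNorm_mul_le_right {q : ℝ} (hq : 1 ≤ q) (x c : A) :
    τ.lqNorm q (x * c) ≤ 2 * ‖c‖ * τ.lqNorm q x := by
  have hq0 : 0 ≤ q := by linarith
  rw [← τ.lqNorm_star hq0 (x * c), star_mul, ← τ.lqNorm_star hq0 x, ← norm_star c]
  exact τ.lqNorm_mul_le_left hq _ _

lemma lqNorm_sub_le {q : ℝ} (hq : 1 ≤ q) (x y : A) :
    τ.lqNorm q (x - y) ≤ τ.lqNorm q x + τ.lqNorm q y := by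
  rw [sub_eq_add_neg, ← τ.lqNorm_neg q y]
  exact τ.lqNorm_add_le hq _ _

lemma lqNorm_sub_comm (q : ℝ) (x y : A) : τ.lqNorm q (x - y) = τ.lqNorm q (y - x) := by
  rw [← neg_sub, lqNorm_neg]

lemma lqNorm_abs (q : ℝ) (x : A) : τ.lqNorm q (CFC.abs x) = τ.lqNorm q x := by
  unfold lqNorm
  rw [CFC.cfcAbs_cfcAbs]

lemma lqNorm_rpow {q : ℝ} (hq : 0 < q) (x : A) : τ.lqNorm q x ^ q = (τ (CFC.abs x ^ q)).re := by
  unfold lqNorm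
  rw [← Real.rpow_mul (τ.re_nonneg CFC.rpow_nonneg), one_div_mul_cancel hq.ne', Real.rpow_one]

lemma lqNorm_cfc {q : ℝ} (hq : 0 ≤ q) {b : A} (hb : IsSelfAdjoint b) {g : ℝ → ℝ}
    (hg : ContinuousOn g (spectrum ℝ b)) :
    τ.lqNorm q (cfc g b) = (τ (cfc (fun t => |g t| ^ q) b)).re ^ (1 / q) := by
  have h : CFC.abs (cfc g b) = cfc (fun t => |g t|) b := by
    rw [CFC.abs_eq_cfc_norm (cfc g b) (cfc_predicate _ _), ← cfc_comp' (‖·‖) g b]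
    rfl
  unfold lqNorm
  rw [CFC.rpow_eq_cfc_real (CFC.abs_nonneg _), h,
    ← cfc_comp' (fun t : ℝ => t ^ q) (fun t => |g t|) b
      (Real.continuous_rpow_const hq).continuousOn hg.abs]

lemma lqNorm_cfc_le_cfc {q : ℝ} (hq : 0 < q) {b : A} (hb : IsSelfAdjoint b) {f g : ℝ → ℝ}
    (hf : ContinuousOn f (spectrum ℝ b)) (hg : ContinuousOn g (spectrum ℝ b))
    (h : ∀ t ∈ spectrum ℝ b, |f t| ≤ |g t|) : τ.lqNorm q (cfc f b) ≤ τ.lqNorm q (cfc g b) := by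
  have hc : ∀ {k : ℝ → ℝ}, ContinuousOn k (spectrum ℝ b) →
      ContinuousOn (fun t => |k t| ^ q) (spectrum ℝ b) := fun hk =>
    hk.abs.rpow_const fun _ _ => Or.inr hq.le
  rw [τ.lqNorm_cfc hq.le hb hf, τ.lqNorm_cfc hq.le hb hg]
  refine Real.rpow_le_rpow ?_ (τ.re_mono (cfc_mono (fun t ht => ?_) (hc hf) (hc hg))) (by positivity)
  · exact τ.re_nonneg (cfc_nonneg fun t _ => by positivity)
  · exact Real.rpow_le_rpow (abs_nonneg _) (h t ht) hq.le

lemma re_apply_algebraMap (c : ℝ) : (τ (algebraMap ℝ A c)).re = c := by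
  rw [Algebra.algebraMap_eq_smul_one, ← Complex.coe_smul, map_smul, τ.map_one']
  simp

lemma re_apply_smul (c : ℝ) (x : A) : (τ (c • x)).re = c * (τ x).re := by
  rw [← Complex.coe_smul, map_smul]
  simp

lemma lqNorm_cfc_le_of_abs_le {q : ℝ} (hq : 0 < q) {b : A} (hb : IsSelfAdjoint b) {f : ℝ → ℝ}
    (hf : ContinuousOn f (spectrum ℝ b)) {c : ℝ} (hc : 0 ≤ c)
    (h : ∀ t ∈ spectrum ℝ b, |f t| ≤ c) : τ.lqNorm q (cfc f b) ≤ c := by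
  refine (τ.lqNorm_cfc_le_cfc hq hb hf (g := fun _ => c) continuousOn_const
    fun t ht => by rw [abs_of_nonneg hc]; exact h t ht).trans ?_
  rw [τ.lqNorm_cfc hq.le hb continuousOn_const, cfc_const _ b hb, re_apply_algebraMap,
    abs_of_nonneg hc, ← Real.rpow_mul hc, mul_one_div_cancel hq.ne', Real.rpow_one]

lemma abs_spectrum_abs_le {x : A} {t : ℝ} (ht : t ∈ spectrum ℝ (CFC.abs x)) : t ≤ ‖x‖ := by
  have : Nontrivial A := by
    by_contra hA
    rw [not_nontrivial_iff_subsingleton] at hA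
    simp [spectrum.of_subsingleton] at ht
  have := spectrum.norm_le_norm_of_mem ht
  rw [CFC.norm_abs] at this
  exact (le_abs_self t).trans this

lemma lqNorm_one_eq (x : A) : τ.lqNorm 1 x = (τ (CFC.abs x)).re := by
  unfold lqNorm
  rw [CFC.rpow_one _ (CFC.abs_nonneg x)]; simp

/-- Evaluate t ≤ r + r^(1-p) t^p at |x| with r = ‖x‖_p: each summand on the right then has trace
`r`. -/
lemma lqNorm_one_le {p : ℝ} (hp : 1 ≤ p) (x : A) : τ.lqNorm 1 x ≤ 2 * τ.lqNorm p x := by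
  have hp0 : 0 < p := by linarith
  have h0 := CFC.abs_nonneg x
  rcases (τ.lqNorm_nonneg p x).eq_or_lt with h | h
  · rw [← h, τ.eq_zero_of_lqNorm_eq_zero hp h.symm, τ.lqNorm_zero le_rfl, mul_zero]
  set r := τ.lqNorm p x with hr
  have hcp : ContinuousOn (fun t : ℝ => t ^ p) (spectrum ℝ (CFC.abs x)) :=
    (Real.continuous_rpow_const hp0.le).continuousOn
  have hcp' : ContinuousOn (fun t : ℝ => r ^ (1 - p) • t ^ p) (spectrum ℝ (CFC.abs x)) :=
    hcp.const_smul (r ^ (1 - p))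
  have h1 : CFC.abs x ≤ algebraMap ℝ A r + r ^ (1 - p) • CFC.abs x ^ p := by
    rw [CFC.rpow_eq_cfc_real h0, ← cfc_smul _ _ _ hcp, ← cfc_const r (CFC.abs x),
      ← cfc_add _ (fun _ => r) _ continuousOn_const hcp']
    nth_rw 1 [← cfc_id' ℝ (CFC.abs x)]
    refine cfc_mono (fun t ht => ?_) (by fun_prop) (continuousOn_const.add hcp')
    have ht0 := spectrum_nonneg h0 ht
    rw [smul_eq_mul]
    rcases le_total t r with htr | htr
    · have : 0 ≤ r ^ (1 - p) * t ^ p := by positivity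
      linarith
    · have htp : 0 < t := h.trans_le htr
      have : t ≤ r ^ (1 - p) * t ^ p := by
        calc t = t ^ (1 - p) * t ^ p := by rw [← Real.rpow_add htp]; simp
          _ ≤ _ := by
            gcongr ?_ * _
            exact Real.rpow_le_rpow_of_nonpos h htr (by linarith)
      linarith
  have h2 := τ.re_mono h1
  rw [map_add, Complex.add_re, re_apply_algebraMap, re_apply_smul, ← τ.lqNorm_rpow hp0, ← hr,
    ← Real.rpow_add h, sub_add_cancel, Real.rpow_one, ← lqNorm_one_eq] at h2
  linarith

/-- On the spectrum of |x| one has t^r ≤ ‖x‖^(r-1) t. Thus smallness in the 1-norm gives smallness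
in the r-norm on operator-norm bounded sets. -/
lemma lqNorm_rpow_le {r : ℝ} (hr : 1 ≤ r) (x : A) :
    τ.lqNorm r x ^ r ≤ ‖x‖ ^ (r - 1) * τ.lqNorm 1 x := by
  have hr0 : 0 < r := by linarith
  have h0 := CFC.abs_nonneg x
  rw [τ.lqNorm_rpow hr0, lqNorm_one_eq, ← re_apply_smul]
  refine τ.re_mono ?_
  nth_rw 2 [← cfc_id' ℝ (CFC.abs x)]
  rw [CFC.rpow_eq_cfc_real h0, ← cfc_smul _ _ _ (by fun_prop)]
  refine cfc_mono (fun t ht => ?_) (Real.continuous_rpow_const hr0.le).continuousOn (by fun_prop)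
  have ht0 := spectrum_nonneg h0 ht
  rw [smul_eq_mul]
  rcases ht0.eq_or_lt with h | h
  · rw [← h, Real.zero_rpow hr0.ne', mul_zero]
  · calc t ^ r = t ^ (r - 1) * t := by
          nth_rw 3 [← Real.rpow_one t]
          rw [← Real.rpow_add h, sub_add_cancel]
      _ ≤ _ := by
        have := abs_spectrum_abs_le ht
        have : 0 ≤ r - 1 := by linarith
        gcongr

/-- Instead of a polar decomposition, factor x = [x(|x|+ε)⁻¹](|x|+ε); the bracket is a contraction,
and ε is arbitrary. -/
lemma norm_apply_le_lqNorm_one (x : A) : ‖τ x‖ ≤ τ.lqNorm 1 x := by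
  have h : ∀ ε : ℝ, 0 < ε → ‖τ x‖ ≤ τ.lqNorm 1 x + ε := by
    intro ε hε
    have h1 : x = x * shift x ε (-1) * shift x ε 1 := by
      rw [mul_assoc, shift_mul_shift x hε, neg_add_cancel, shift_zero, mul_one]
    have h2 : shift x ε 1 = CFC.abs x + algebraMap ℝ A ε := by
      unfold shift
      simp only [Real.rpow_one]
      have hsa := (CFC.abs_nonneg x).isSelfAdjoint
      rw [cfc_add (CFC.abs x) (fun t : ℝ => t) (fun _ => ε), cfc_const ε _ hsa, cfc_id' ℝ _ hsa]
    have h3 : (τ (shift x ε 1)).re = τ.lqNorm 1 x + ε := by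
      rw [h2, map_add, Complex.add_re, re_apply_algebraMap, lqNorm_one_eq]
    rw [← h3]
    nth_rw 1 [h1]
    rw [mul_comm_apply]
    refine (τ.norm_mul_le (shift_nonneg x hε 1) _).trans ?_
    exact mul_le_of_le_one_right (τ.re_nonneg (shift_nonneg x hε 1)) (norm_mul_shift_le x hε)
  exact le_of_forall_pos_le_add h

end Ideal

end NormalFaithfulTrace

namespace NormalFaithfulTrace

open scoped ComplexOrder

/-! ### Continuity of a ↦ |a|^(p/r) from the p-norm to the r-norm. -/

section AbsRpow

variable {A : Type*} [CStarAlgebra A] [PartialOrder A] [StarOrderedRing A]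

/-- The element `(1 + |a|²)⁻¹`. -/
noncomputable def absResolvent (a : A) : A := cfc (fun t : ℝ => (1 + t ^ 2)⁻¹) (CFC.abs a)

lemma continuous_inv_one_add_sq : Continuous fun t : ℝ => (1 + t ^ 2)⁻¹ :=
  Continuous.inv₀ (by fun_prop) fun t => by positivity

lemma one_add_mul_absResolvent (a : A) : (1 + star a * a) * absResolvent a = 1 := by
  have hsa : IsSelfAdjoint (CFC.abs a) := (CFC.abs_nonneg a).isSelfAdjoint
  have h : 1 + star a * a = cfc (fun t : ℝ => 1 + t ^ 2) (CFC.abs a) := by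
    rw [cfc_add (CFC.abs a) (fun _ : ℝ => 1) (fun t => t ^ 2), cfc_const_one ℝ _ hsa,
      cfc_pow_id _ 2 hsa, CFC.abs_sq]
  rw [h, absResolvent, ← cfc_mul _ _ _ (by fun_prop) continuous_inv_one_add_sq.continuousOn,
    ← cfc_const_one ℝ _ hsa]
  exact cfc_congr fun t _ => mul_inv_cancel₀ (by positivity)

lemma star_absResolvent (a : A) : star (absResolvent a) = absResolvent a :=
  (cfc_predicate (R := ℝ) _ _ : IsSelfAdjoint (absResolvent a)).star_eq

lemma absResolvent_mul_one_add (a : A) : absResolvent a * (1 + star a * a) = 1 := by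
  have h := congrArg star (one_add_mul_absResolvent a)
  simpa [star_absResolvent] using h

lemma norm_absResolvent_le (a : A) : ‖absResolvent a‖ ≤ 1 :=
  norm_cfc_le zero_le_one fun t _ => by
    rw [Real.norm_of_nonneg (by positivity)]
    exact inv_le_one_of_one_le₀ (by nlinarith [sq_nonneg t])

lemma norm_mul_absResolvent_le (a : A) : ‖a * absResolvent a‖ ≤ 1 := by
  have hsa : IsSelfAdjoint (CFC.abs a) := (CFC.abs_nonneg a).isSelfAdjoint
  have hc := continuous_inv_one_add_sq
  have h : ‖a * absResolvent a‖ * ‖a * absResolvent a‖ ≤ 1 := by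
    rw [← CStarRing.norm_star_mul_self, star_mul, star_absResolvent, mul_assoc,
      ← mul_assoc (star a), ← CFC.abs_sq, ← cfc_pow_id (R := ℝ) _ 2 hsa, absResolvent,
      ← cfc_mul _ _ _ (by fun_prop) hc.continuousOn,
      ← cfc_mul _ (fun t : ℝ => t ^ 2 * (1 + t ^ 2)⁻¹) _ hc.continuousOn
        ((continuous_id.pow 2).mul hc).continuousOn]
    refine norm_cfc_le zero_le_one fun t _ => ?_
    rw [Real.norm_of_nonneg (by positivity), ← mul_assoc, mul_comm, ← mul_assoc, ← mul_inv,
      inv_mul_le_one₀ (by positivity)]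
    nlinarith [sq_nonneg t, sq_nonneg (t ^ 2)]
  nlinarith [norm_nonneg (a * absResolvent a)]

/-- Resolvent identity combined with b⋆b - a⋆a = (b-a)⋆b + a⋆(b-a). Every `a` or `b` outside the
difference b - a is paired with its own resolvent, where the product has norm at most 1; hence a
Lipschitz constant independent of `a` and `b`. -/
lemma absResolvent_sub (a b : A) : absResolvent a - absResolvent b =
    absResolvent a * star (b - a) * (b * absResolvent b) +
      star (a * absResolvent a) * (b - a) * absResolvent b := by
  have h : absResolvent a - absResolvent b =
      absResolvent a * (1 + star b * b) * absResolvent b -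
        absResolvent a * (1 + star a * a) * absResolvent b := by
    rw [mul_assoc, one_add_mul_absResolvent, mul_one, absResolvent_mul_one_add, one_mul]
  rw [h, star_sub, star_mul, star_absResolvent]
  noncomm_ring

variable (τ : NormalFaithfulTrace A)

lemma lqNorm_absResolvent_sub_le {p : ℝ} (hp : 1 ≤ p) (a b : A) :
    τ.lqNorm p (absResolvent a - absResolvent b) ≤ 8 * τ.lqNorm p (a - b) := by
  have key : ∀ c y d : A, ‖c‖ ≤ 1 → ‖d‖ ≤ 1 → τ.lqNorm p (c * y * d) ≤ 4 * τ.lqNorm p y := by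
    intro c y d hc hd
    have h1 := τ.lqNorm_mul_le_right hp (c * y) d
    have h2 := τ.lqNorm_mul_le_left hp c y
    have h3 := mul_le_mul_of_nonneg_right hc (τ.lqNorm_nonneg p y)
    have h4 := mul_le_mul_of_nonneg_right hd (τ.lqNorm_nonneg p (c * y))
    linarith
  have h1 := key _ (star (b - a)) _ (norm_absResolvent_le a) (norm_mul_absResolvent_le b)
  have h2 := key _ (b - a) _ ((norm_star _).trans_le (norm_mul_absResolvent_le a))
    (norm_absResolvent_le b)
  rw [τ.lqNorm_star (by linarith)] at h1
  rw [absResolvent_sub, τ.lqNorm_sub_comm p a b]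
  linarith [τ.lqNorm_add_le hp (absResolvent a * star (b - a) * (b * absResolvent b))
    (star (a * absResolvent a) * (b - a) * absResolvent b)]

/-- The Lipschitz property passes to products because the factors are also bounded in operator norm,
uniformly in the element. -/
lemma exists_lqNorm_aeval_absResolvent_sub_le {p : ℝ} (hp : 1 ≤ p) (P : Polynomial ℝ) :
    ∃ C : ℝ, 0 ≤ C ∧ ∀ a b : A, τ.lqNorm p (Polynomial.aeval (absResolvent a) P -
      Polynomial.aeval (absResolvent b) P) ≤ C * τ.lqNorm p (a - b) := by
  induction P using Polynomial.induction_on with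
  | C c => exact ⟨0, le_rfl, fun a b => by simp [τ.lqNorm_zero hp]⟩
  | add P R hP hR =>
    obtain ⟨C, hC0, hC⟩ := hP
    obtain ⟨D, hD0, hD⟩ := hR
    refine ⟨C + D, by positivity, fun a b => ?_⟩
    rw [map_add, map_add, add_sub_add_comm, add_mul]
    exact (τ.lqNorm_add_le hp _ _).trans (add_le_add (hC a b) (hD a b))
  | monomial n c ih =>
    obtain ⟨C, hC0, hC⟩ := ih
    set Q : Polynomial ℝ := Polynomial.C c * Polynomial.X ^ n with hQ
    have hbd : ∀ b : A, ‖Polynomial.aeval (absResolvent b) Q‖ ≤ |c| := by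
      intro b
      have hb : IsSelfAdjoint (CFC.abs b) := (CFC.abs_nonneg b).isSelfAdjoint
      rw [absResolvent, ← cfc_map_polynomial Q _ _ hb continuous_inv_one_add_sq.continuousOn]
      refine norm_cfc_le (abs_nonneg c) fun t _ => ?_
      have h1 : (1 + t ^ 2)⁻¹ ≤ 1 := inv_le_one_of_one_le₀ (by nlinarith [sq_nonneg t])
      have h2 : ((1 + t ^ 2)⁻¹) ^ n ≤ 1 := pow_le_one₀ (by positivity) h1
      simp only [hQ, Polynomial.eval_mul, Polynomial.eval_C, Polynomial.eval_pow, Polynomial.eval_X]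
      rw [norm_mul, Real.norm_eq_abs, Real.norm_of_nonneg (by positivity)]
      exact mul_le_of_le_one_right (abs_nonneg c) h2
    refine ⟨2 * C + 16 * |c|, by positivity, fun a b => ?_⟩
    have hs : Polynomial.aeval (absResolvent a) (Polynomial.C c * Polynomial.X ^ (n + 1)) -
        Polynomial.aeval (absResolvent b) (Polynomial.C c * Polynomial.X ^ (n + 1)) =
        (Polynomial.aeval (absResolvent a) Q - Polynomial.aeval (absResolvent b) Q) *
          absResolvent a +
        Polynomial.aeval (absResolvent b) Q * (absResolvent a - absResolvent b) := by
      have e : Polynomial.C c * Polynomial.X ^ (n + 1) = Q * Polynomial.X := by rw [hQ]; ring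
      rw [e, map_mul _ Q, map_mul _ Q, Polynomial.aeval_X, Polynomial.aeval_X]
      noncomm_ring
    rw [hs]
    refine (τ.lqNorm_add_le hp _ _).trans ?_
    rw [add_mul]
    have h0 := τ.lqNorm_nonneg p (a - b)
    refine add_le_add ((τ.lqNorm_mul_le_right hp _ _).trans ?_)
      ((τ.lqNorm_mul_le_left hp _ _).trans ?_)
    · have h1 := norm_absResolvent_le a
      calc _ ≤ 2 * 1 * (C * τ.lqNorm p (a - b)) := by
            gcongr
            · exact τ.lqNorm_nonneg _ _
            · exact hC a b
        _ = _ := by ring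
    · calc _ ≤ 2 * |c| * (8 * τ.lqNorm p (a - b)) := by
            gcongr
            · exact τ.lqNorm_nonneg _ _
            · exact hbd b
            · exact τ.lqNorm_absResolvent_sub_le hp a b
        _ = _ := by ring

lemma exists_norm_aeval_absResolvent_le (P : Polynomial ℝ) :
    ∃ B : ℝ, 0 ≤ B ∧ ∀ a : A, ‖Polynomial.aeval (absResolvent a) P‖ ≤ B := by
  obtain ⟨B, hB⟩ := (isCompact_Icc (a := (0 : ℝ)) (b := 1)).exists_bound_of_continuousOn
    (f := fun t => P.eval t) (by fun_prop)
  refine ⟨B, (norm_nonneg _).trans (hB 0 (by simp)), fun a => ?_⟩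
  have ha : IsSelfAdjoint (CFC.abs a) := (CFC.abs_nonneg a).isSelfAdjoint
  rw [absResolvent, ← cfc_map_polynomial P _ _ ha continuous_inv_one_add_sq.continuousOn]
  exact norm_cfc_le ((norm_nonneg _).trans (hB 0 (by simp))) fun t _ =>
    hB _ ⟨by positivity, inv_le_one_of_one_le₀ (by nlinarith [sq_nonneg t])⟩

lemma lqNorm_mul_cfc_abs {p : ℝ} (a : A) {g : ℝ → ℝ} (hg : Continuous g) :
    τ.lqNorm p (a * cfc g (CFC.abs a)) = τ.lqNorm p (cfc (fun t => t * g t) (CFC.abs a)) := by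
  have hsa : IsSelfAdjoint (CFC.abs a) := (CFC.abs_nonneg a).isSelfAdjoint
  have h1 : star (cfc g (CFC.abs a)) = cfc g (CFC.abs a) :=
    (cfc_predicate (R := ℝ) _ _ : IsSelfAdjoint (cfc g (CFC.abs a))).star_eq
  have h : CFC.abs (a * cfc g (CFC.abs a)) = CFC.abs (cfc (fun t => t * g t) (CFC.abs a)) := by
    have h2 : cfc (fun t => t * g t) (CFC.abs a) = CFC.abs a * cfc g (CFC.abs a) := by
      rw [cfc_mul (fun t => t) g _ (by fun_prop) hg.continuousOn, cfc_id' ℝ _ hsa]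
    rw [h2]
    refine congrArg CFC.sqrt ?_
    rw [star_mul, star_mul, h1, hsa.star_eq, mul_assoc, mul_assoc, ← mul_assoc (star a),
      ← mul_assoc (CFC.abs a), CFC.abs_mul_abs]
  unfold lqNorm
  rw [h]

/-- If `g` vanishes on `[0, L]`, where `L` is large compared to `‖b‖`, then `|a| g(|a|)` is
controlled by the distance from `a` to `b`. -/
lemma lqNorm_cfc_mul_le {p : ℝ} (hp : 1 ≤ p) (a b : A) {g : ℝ → ℝ} (hg : Continuous g)
    (hg0 : ∀ t, 0 ≤ g t) (hg1 : ∀ t, g t ≤ 1) {L : ℝ} (hL0 : 0 < L) (hL : 4 * ‖b‖ ≤ L)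
    (hgL : ∀ t, 0 ≤ t → t ≤ L → g t = 0) :
    τ.lqNorm p (cfc (fun t => t * g t) (CFC.abs a)) ≤ 4 * τ.lqNorm p (a - b) := by
  have h0 := CFC.abs_nonneg a
  set N := τ.lqNorm p (cfc (fun t => t * g t) (CFC.abs a)) with hN
  have hN0 : 0 ≤ N := τ.lqNorm_nonneg _ _
  have h1 : N ≤ τ.lqNorm p ((a - b) * cfc g (CFC.abs a)) + τ.lqNorm p (b * cfc g (CFC.abs a)) := by
    rw [hN, ← τ.lqNorm_mul_cfc_abs a hg]
    refine le_trans (le_of_eq ?_) (τ.lqNorm_add_le hp _ _)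
    rw [← add_mul, sub_add_cancel]
  have h2 : ‖cfc g (CFC.abs a)‖ ≤ 1 := norm_cfc_le zero_le_one fun t _ => by
    rw [Real.norm_of_nonneg (hg0 t)]; exact hg1 t
  have h3 := τ.lqNorm_mul_le_right hp (a - b) (cfc g (CFC.abs a))
  have h4 := τ.lqNorm_mul_le_left hp b (cfc g (CFC.abs a))
  -- Since `g` vanishes below `L`, g(t) ≤ L⁻¹ t g(t). The term with `b` is then at most 2‖b‖L⁻¹N ≤
  -- N/2 and is absorbed on the left, which doubles the constant 2 to 4.
  have h5 : τ.lqNorm p (cfc g (CFC.abs a)) ≤ L⁻¹ * N := by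
    have e : L⁻¹ * N = τ.lqNorm p (cfc (fun t => L⁻¹ * (t * g t)) (CFC.abs a)) := by
      rw [cfc_const_mul L⁻¹ (fun t => t * g t) (CFC.abs a), ← Complex.coe_smul, τ.lqNorm_smul hp,
        Complex.norm_real, Real.norm_of_nonneg (by positivity)]
    rw [e]
    refine τ.lqNorm_cfc_le_cfc (by linarith) h0.isSelfAdjoint (by fun_prop) (by fun_prop)
      fun t ht => ?_
    have ht0 := spectrum_nonneg h0 ht
    have := hg0 t
    rw [abs_of_nonneg this, abs_of_nonneg (by positivity)]
    rcases le_total t L with h | h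
    · simp [hgL t ht0 h]
    · rw [← mul_assoc]
      refine le_mul_of_one_le_left this ?_
      rw [inv_mul_eq_div, one_le_div hL0]; exact h
  have h6 : 2 * ‖b‖ * τ.lqNorm p (cfc g (CFC.abs a)) ≤ N / 2 := by
    calc _ ≤ 2 * ‖b‖ * (L⁻¹ * N) := by gcongr
      _ = (4 * ‖b‖) * L⁻¹ * (N / 2) := by ring
      _ ≤ L * L⁻¹ * (N / 2) := by gcongr
      _ = N / 2 := by rw [mul_inv_cancel₀ hL0.ne', one_mul]
  have h7 := mul_le_mul_of_nonneg_right h2 (τ.lqNorm_nonneg p (a - b))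
  linarith

/-- The power `|a| ^ s` is approximated by polynomials in `(1 + |a|²)⁻¹`, uniformly for `a` in a
ball of the `p`-norm around an element of the algebra. -/
lemma exists_lqNorm_abs_rpow_sub_aeval_le {p r : ℝ} (hp : 1 ≤ p) (hr : 1 ≤ r) (b : A) {η : ℝ}
    (hη : 0 < η) : ∃ P : Polynomial ℝ, ∀ a : A,
      τ.lqNorm r (CFC.abs a ^ (p / r) - Polynomial.aeval (absResolvent a) P) ≤
        (4 * τ.lqNorm p (a - b)) ^ (p / r) + η := by
  have hr0 : 0 < r := by linarith
  have hp0 : 0 < p := by linarith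
  set s := p / r with hs
  have hs0 : 0 < s := by positivity
  set φ : ℝ → ℝ := fun t => (1 + t ^ 2)⁻¹ with hφ
  have hφc : Continuous φ := continuous_inv_one_add_sq
  have hφ1 : ∀ t, φ t ≤ 1 := fun t => inv_le_one_of_one_le₀ (by nlinarith [sq_nonneg t])
  have hφ0 : ∀ t, 0 < φ t := fun t => by positivity
  set L : ℝ := 4 * ‖b‖ + 1 with hL
  have hL0 : 0 < L := by positivity
  -- The cutoff κ acts on v = φ(t), which decreases for t ≥ 0: κ(φ(t)) is 0 for t ≤ L, where φ(t) ≥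
  -- 2u, and 1 once φ(t) ≤ u, that is for large t.
  set u : ℝ := φ L / 2 with hu
  have hu0 : 0 < u := half_pos (hφ0 L)
  set κ : ℝ → ℝ := fun v => max 0 (min 1 (2 - v / u)) with hκ
  have hκc : Continuous κ := by fun_prop
  have hκ0 : ∀ v, 0 ≤ κ v := fun v => le_max_left _ _
  have hκ1 : ∀ v, κ v ≤ 1 := fun v => max_le zero_le_one (min_le_left _ _)
  have hκu : ∀ v, v ≤ u → κ v = 1 := fun v hv => by
    have : v / u ≤ 1 := (div_le_one hu0).mpr hv
    simp only [hκ]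
    rw [min_eq_left (by linarith), max_eq_right zero_le_one]
  have hκu' : ∀ v, 2 * u ≤ v → κ v = 0 := fun v hv => by
    have : 2 ≤ v / u := (le_div_iff₀ hu0).mpr hv
    simp only [hκ]
    exact max_eq_left ((min_le_right _ _).trans (by linarith))
  -- `G` expresses the truncated power t^s - (t κ(φ(t)))^s as a function of v = φ(t). It vanishes
  -- for v ≤ u, so the singularity of v⁻¹ at 0 is harmless; replacing `v` by `max v u` only makes
  -- continuity evident.
  set G : ℝ → ℝ := fun v => ((max v u)⁻¹ - 1) ^ (s / 2) * (1 - κ v ^ s) with hG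
  have hGc : Continuous G := by
    refine Continuous.mul (Continuous.rpow_const (Continuous.sub (Continuous.inv₀ (by fun_prop)
      fun v => (hu0.trans_le (le_max_right _ _)).ne') continuous_const)
      fun _ => Or.inr (by positivity)) (continuous_const.sub (hκc.rpow_const fun _ => Or.inr hs0.le))
  have hGφ : ∀ t, 0 ≤ t → G (φ t) = t ^ s - (t * κ (φ t)) ^ s := by
    intro t ht
    rw [Real.mul_rpow ht (hκ0 _)]
    simp only [hG]
    rcases le_total (φ t) u with h | h
    · rw [hκu _ h]; simp
    · rw [max_eq_left h]
      simp only [hφ, inv_inv, add_sub_cancel_left]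
      rw [← Real.rpow_natCast t 2, ← Real.rpow_mul ht]
      rw [show ((2 : ℕ) : ℝ) * (s / 2) = s by push_cast; ring]
      ring
  obtain ⟨P, hP⟩ := exists_polynomial_near_of_continuousOn 0 1 G hGc.continuousOn η hη
  refine ⟨P, fun a => ?_⟩
  have h0 := CFC.abs_nonneg a
  have hsa := h0.isSelfAdjoint
  have hPc : Continuous fun t : ℝ => P.eval (φ t) := P.continuous.comp hφc
  have hGφc : Continuous fun t : ℝ => G (φ t) := hGc.comp hφc
  have htk : Continuous fun t : ℝ => t * κ (φ t) := continuous_id.mul (hκc.comp hφc)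
  have htc : Continuous fun t : ℝ => (t * κ (φ t)) ^ s :=
    htk.rpow_const fun _ => Or.inr hs0.le
  have e1 : CFC.abs a ^ s = cfc (fun t => (t * κ (φ t)) ^ s) (CFC.abs a) +
      cfc (fun t => G (φ t)) (CFC.abs a) := by
    rw [CFC.rpow_eq_cfc_real h0, ← cfc_add _ _ _ htc.continuousOn hGφc.continuousOn]
    refine cfc_congr fun t ht => ?_
    rw [hGφ t (spectrum_nonneg h0 ht)]; ring
  have e2 : Polynomial.aeval (absResolvent a) P = cfc (fun t => P.eval (φ t)) (CFC.abs a) :=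
    (cfc_map_polynomial P _ _ hsa hφc.continuousOn).symm
  rw [e1, e2, add_sub_assoc, ← cfc_sub _ _ _ hGφc.continuousOn hPc.continuousOn]
  refine (τ.lqNorm_add_le hr _ _).trans (add_le_add ?_ ?_)
  · have h1 : τ.lqNorm p (cfc (fun t => t * κ (φ t)) (CFC.abs a)) ≤ 4 * τ.lqNorm p (a - b) :=
      τ.lqNorm_cfc_mul_le hp a b (hκc.comp hφc) (fun t => hκ0 _) (fun t => hκ1 _) hL0
        (by linarith) fun t ht htL => hκu' _ (by
          rw [hu, mul_div_cancel₀ _ two_ne_zero]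
          simp only [hφ]
          gcongr)
    -- As s r = p, the r-norm of the s-th power of a nonnegative function of |a| is the s-th power
    -- of its p-norm.
    refine le_trans (le_of_eq ?_) (Real.rpow_le_rpow (τ.lqNorm_nonneg _ _) h1 hs0.le)
    rw [τ.lqNorm_cfc hr0.le hsa htc.continuousOn, τ.lqNorm_cfc hp0.le hsa htk.continuousOn, ← Real.rpow_mul
        (τ.re_nonneg (cfc_nonneg fun t _ => by positivity))]
    congr 3
    · refine cfc_congr fun t ht => ?_
      have ht0 : 0 ≤ t * κ (φ t) := mul_nonneg (spectrum_nonneg h0 ht) (hκ0 _)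
      change |(t * κ (φ t)) ^ s| ^ r = |t * κ (φ t)| ^ p
      rw [abs_of_nonneg (by positivity), abs_of_nonneg ht0, ← Real.rpow_mul ht0, hs,
        div_mul_cancel₀ _ hr0.ne']
    · rw [hs]; field_simp
  · refine τ.lqNorm_cfc_le_of_abs_le hr0 hsa (hGφc.sub hPc).continuousOn hη.le fun t _ => ?_
    rw [Pi.sub_apply, abs_sub_comm]
    exact (hP _ ⟨(hφ0 t).le, hφ1 t⟩).le

/-- The map `a ↦ |a| ^ (p / r)` is uniformly continuous from the `p`-norm to the `r`-norm up to an
error that is small near `b`. -/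
lemma exists_lqNorm_abs_rpow_sub_lt {p r : ℝ} (hp : 1 ≤ p) (hr : 1 ≤ r) {ε : ℝ} (hε : 0 < ε) :
    ∃ δ : ℝ, 0 < δ ∧ ∀ b : A, ∃ η : ℝ, 0 < η ∧ ∀ a a' : A, τ.lqNorm p (a - b) < δ →
      τ.lqNorm p (a' - b) < δ → τ.lqNorm p (a - a') < η →
      τ.lqNorm r (CFC.abs a ^ (p / r) - CFC.abs a' ^ (p / r)) < ε := by
  have hr0 : 0 < r := by linarith
  have hp0 : 0 < p := by linarith
  have hs0 : 0 < p / r := by positivity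
  -- This δ solves (4δ)^(p/r) = ε/8. With polynomial error ε/8 it leaves ε/4 at each of `a` and
  -- `a'`. It does not depend on `b`, which matters for the extension to the completion.
  refine ⟨(ε / 8) ^ (p / r)⁻¹ / 4, by positivity, fun b => ?_⟩
  obtain ⟨P, hP⟩ := τ.exists_lqNorm_abs_rpow_sub_aeval_le hp hr b (show 0 < ε / 8 by positivity)
  obtain ⟨C, hC0, hC⟩ := τ.exists_lqNorm_aeval_absResolvent_sub_le hp P
  obtain ⟨B, hB0, hB⟩ := exists_norm_aeval_absResolvent_le (A := A) P
  set K := (2 * B) ^ (r - 1) * (2 * C) + 1 with hK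
  have hK0 : 0 < K := by positivity
  -- Chosen so that ‖a - a'‖_p < η forces (2B)^(r-1) · 2C‖a - a'‖_p < (ε/2)^r. This bounds the
  -- r-norm of the polynomial difference through its 1-norm; the summand 1 in `K` keeps it positive.
  refine ⟨(ε / 2) ^ r / K, by positivity, fun a a' ha ha' haa => ?_⟩
  have key : ∀ a : A, τ.lqNorm p (a - b) < (ε / 8) ^ (p / r)⁻¹ / 4 →
      τ.lqNorm r (CFC.abs a ^ (p / r) - Polynomial.aeval (absResolvent a) P) ≤ ε / 4 := by
    intro a ha
    refine (hP a).trans ?_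
    have h1 : (4 * τ.lqNorm p (a - b)) ^ (p / r) ≤ ((ε / 8) ^ (p / r)⁻¹) ^ (p / r) :=
      Real.rpow_le_rpow (mul_nonneg (by norm_num) (τ.lqNorm_nonneg _ _)) (by linarith) hs0.le
    rw [← Real.rpow_mul (by positivity), inv_mul_cancel₀ hs0.ne', Real.rpow_one] at h1
    linarith
  have h1 := key a ha
  have h2 := key a' ha'
  set x := Polynomial.aeval (absResolvent a) P
  set y := Polynomial.aeval (absResolvent a') P
  have h3 : τ.lqNorm r (x - y) < ε / 2 := by
    refine lt_of_not_ge fun hle => ?_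
    have h4 := τ.lqNorm_rpow_le hr (x - y)
    have h5 : ‖x - y‖ ≤ 2 * B := (norm_sub_le _ _).trans (by linarith [hB a, hB a'])
    have h6 : τ.lqNorm 1 (x - y) ≤ 2 * C * τ.lqNorm p (a - a') := by
      linarith [τ.lqNorm_one_le hp (x - y), hC a a']
    have h7 : (ε / 2) ^ r ≤ τ.lqNorm r (x - y) ^ r := Real.rpow_le_rpow (by positivity) hle hr0.le
    have h8 : ‖x - y‖ ^ (r - 1) * τ.lqNorm 1 (x - y) ≤
        (2 * B) ^ (r - 1) * (2 * C * τ.lqNorm p (a - a')) := by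
      have : 0 ≤ r - 1 := by linarith
      have := τ.lqNorm_nonneg 1 (x - y)
      gcongr
    rw [lt_div_iff₀ hK0] at haa
    have h9 := τ.lqNorm_nonneg p (a - a')
    have h10 : τ.lqNorm p (a - a') * K = (2 * B) ^ (r - 1) * (2 * C * τ.lqNorm p (a - a')) +
      τ.lqNorm p (a - a') := by rw [hK]; ring
    linarith
  have e : CFC.abs a ^ (p / r) - CFC.abs a' ^ (p / r) =
      (CFC.abs a ^ (p / r) - x) + ((x - y) - (CFC.abs a' ^ (p / r) - y)) := by abel
  rw [e]
  linarith [τ.lqNorm_add_le hr (CFC.abs a ^ (p / r) - x) ((x - y) - (CFC.abs a' ^ (p / r) - y)),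
    τ.lqNorm_sub_le hr (x - y) (CFC.abs a' ^ (p / r) - y)]

end AbsRpow

end NormalFaithfulTrace

namespace NormalFaithfulTrace

open scoped ComplexOrder

/-! ### Passage to the completions and reduction to the norms of the individual terms. -/

section Extension

open UniformSpace Filter Topology

variable {A : Type*} [CStarAlgebra A] [PartialOrder A] [StarOrderedRing A]
  (τ : NormalFaithfulTrace A)

/-- The continuity property under which a map of the algebra extends to `L_p → L_r`. -/
def LocallyUniformlyContinuousLq (p r : ℝ) (f : A → A) : Prop :=
  ∀ ε : ℝ, 0 < ε → ∃ δ : ℝ, 0 < δ ∧ ∀ b : A, ∃ η : ℝ, 0 < η ∧ ∀ a a' : A,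
    τ.lqNorm p (a - b) < δ → τ.lqNorm p (a' - b) < δ → τ.lqNorm p (a - a') < η →
    τ.lqNorm r (f a - f a') < ε

variable {τ}

lemma LocallyUniformlyContinuousLq.cauchy {p r : ℝ} [Fact (1 ≤ p)] [Fact (1 ≤ r)] {f : A → A}
    (hf : τ.LocallyUniformlyContinuousLq p r f) (x : τ.Lq p) :
    Cauchy (map (fun a : τ.PreLq p => ((τ.toPreLq r (f (τ.ofPreLq a)) : τ.PreLq r) : τ.Lq r))
      (comap ((↑) : τ.PreLq p → τ.Lq p) (𝓝 x))) := by
  have hne : (comap ((↑) : τ.PreLq p → τ.Lq p) (𝓝 x)).NeBot :=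
    (Completion.isDenseInducing_coe (α := τ.PreLq p)).comap_nhds_neBot x
  refine Metric.cauchy_iff.mpr ⟨hne.map _, fun ε hε => ?_⟩
  obtain ⟨δ, hδ, h⟩ := hf ε hε
  -- The radius δ is available before `b`, so an algebra element `b` can be picked within δ/2 of
  -- `x`; all algebra elements within δ/2 of `x` then lie in the δ-ball around `b`.
  obtain ⟨b, hb⟩ := Completion.denseRange_coe.exists_dist_lt x (half_pos hδ)
  obtain ⟨η, hη, h⟩ := h (τ.ofPreLq b)
  refine ⟨_, image_mem_map (preimage_mem_comap
    (Metric.ball_mem_nhds x (lt_min (half_pos hδ) (half_pos hη)))), ?_⟩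
  rintro _ ⟨a, ha, rfl⟩ _ ⟨a', ha', rfl⟩
  simp only [Set.mem_preimage, Metric.mem_ball, lt_min_iff] at ha ha'
  have hd : ∀ c d : τ.PreLq p, dist (c : τ.Lq p) (d : τ.Lq p) =
      τ.lqNorm p (τ.ofPreLq c - τ.ofPreLq d) := fun c d => by
    rw [Completion.dist_eq, dist_eq_norm]; rfl
  have hd' : ∀ c d : τ.PreLq r, dist (c : τ.Lq r) (d : τ.Lq r) =
      τ.lqNorm r (τ.ofPreLq c - τ.ofPreLq d) := fun c d => by
    rw [Completion.dist_eq, dist_eq_norm]; rfl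
  rw [hd']
  refine h (τ.ofPreLq a) (τ.ofPreLq a') ?_ ?_ ?_
  · rw [← hd]
    linarith [dist_triangle (a : τ.Lq p) x b]
  · rw [← hd]
    linarith [dist_triangle (a' : τ.Lq p) x b]
  · rw [← hd]
    linarith [dist_triangle_right (a : τ.Lq p) a' x]

lemma LocallyUniformlyContinuousLq.continuous_extendLq {p r : ℝ} [Fact (1 ≤ p)] [Fact (1 ≤ r)]
    {f : A → A} (hf : τ.LocallyUniformlyContinuousLq p r f) : Continuous (τ.extendLq p r f) :=
  Completion.isDenseInducing_coe.continuous_extend_of_cauchy hf.cauchy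

lemma LocallyUniformlyContinuousLq.extendLq_coe {p r : ℝ} [Fact (1 ≤ p)] [Fact (1 ≤ r)]
    {f : A → A} (hf : τ.LocallyUniformlyContinuousLq p r f) (a : τ.PreLq p) :
    τ.extendLq p r f a = ((τ.toPreLq r (f (τ.ofPreLq a)) : τ.PreLq r) : τ.Lq r) := by
  refine Completion.isDenseInducing_coe.extend_eq_at ?_
  obtain ⟨c, hc⟩ := CompleteSpace.complete (hf.cauchy a)
  rw [← Completion.isDenseInducing_coe.nhds_eq_comap] at hc
  exact continuousAt_of_tendsto_nhds hc

variable (τ)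

lemma locallyUniformlyContinuousLq_abs_rpow {p r : ℝ} (hp : 1 ≤ p) (hr : 1 ≤ r) :
    τ.LocallyUniformlyContinuousLq p r fun a => CFC.abs a ^ (p / r) :=
  fun _ hε => τ.exists_lqNorm_abs_rpow_sub_lt hp hr hε

lemma continuous_absRpow (p r : ℝ) [hp : Fact (1 ≤ p)] [hr : Fact (1 ≤ r)] :
    Continuous (τ.absRpow p r) :=
  (τ.locallyUniformlyContinuousLq_abs_rpow hp.out hr.out).continuous_extendLq

lemma absRpow_coe (p r : ℝ) [hp : Fact (1 ≤ p)] [hr : Fact (1 ≤ r)] (a : τ.PreLq p) :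
    τ.absRpow p r a = ((τ.toPreLq r (CFC.abs (τ.ofPreLq a) ^ (p / r)) : τ.PreLq r) : τ.Lq r) :=
  (τ.locallyUniformlyContinuousLq_abs_rpow hp.out hr.out).extendLq_coe a

lemma lqNorm_abs_rpow {p r : ℝ} (hp : 0 < p) (hr : 0 < r) (a : A) :
    τ.lqNorm r (CFC.abs a ^ (p / r)) = τ.lqNorm p a ^ (p / r) := by
  have h : (CFC.abs a ^ (p / r)) ^ r = CFC.abs a ^ p := by
    rw [CFC.rpow_rpow_of_exponent_nonneg _ _ _ (by positivity) hr.le (CFC.abs_nonneg a),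
      div_mul_cancel₀ _ hr.ne']
  unfold lqNorm
  rw [CFC.abs_of_nonneg _ CFC.rpow_nonneg, h, ← Real.rpow_mul (τ.re_nonneg CFC.rpow_nonneg)]
  congr 1
  field_simp

lemma norm_absRpow (p r : ℝ) [hp : Fact (1 ≤ p)] [hr : Fact (1 ≤ r)] (x : τ.Lq p) :
    ‖τ.absRpow p r x‖ = ‖x‖ ^ (p / r) := by
  have hp0 : 0 < p := by linarith [hp.out]
  have hr0 : 0 < r := by linarith [hr.out]
  induction x using Completion.induction_on with
  | hp =>
    exact isClosed_eq (τ.continuous_absRpow p r).norm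
      (continuous_norm.rpow_const fun _ => Or.inr (by positivity))
  | ih a =>
    rw [absRpow_coe, Completion.norm_coe, Completion.norm_coe]
    exact τ.lqNorm_abs_rpow hp0 hr0 _

/-- The trace on `L_1`. -/
noncomputable def traceLq : NormedAddGroupHom (τ.Lq 1) ℂ :=
  NormedAddGroupHom.extension
    (AddMonoidHom.mkNormedAddGroupHom
      (τ.toPositiveLinearMap.toLinearMap.toAddMonoidHom.comp
        (τ.ofPreLq (q := 1)).toLinearMap.toAddMonoidHom) 1
      fun a => by rw [one_mul]; exact τ.norm_apply_le_lqNorm_one (τ.ofPreLq a))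

lemma traceLq_coe (a : τ.PreLq 1) : τ.traceLq a = τ (τ.ofPreLq a) :=
  NormedAddGroupHom.extension_coe _ a

lemma norm_traceLq_le (x : τ.Lq 1) : ‖τ.traceLq x‖ ≤ ‖x‖ := by
  induction x using Completion.induction_on with
  | hp => exact isClosed_le τ.traceLq.continuous.norm continuous_norm
  | ih a =>
    rw [traceLq_coe, Completion.norm_coe]
    exact τ.norm_apply_le_lqNorm_one _

lemma traceLq_absRpow (q : ℝ) [hq : Fact (1 ≤ q)] (x : τ.Lq q) :
    τ.traceLq (τ.absRpow q 1 x) = ((‖x‖ ^ q : ℝ) : ℂ) := by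
  have hq0 : 0 < q := by linarith [hq.out]
  induction x using Completion.induction_on with
  | hp =>
    exact isClosed_eq (τ.traceLq.continuous.comp (τ.continuous_absRpow q 1))
      (Complex.continuous_ofReal.comp (continuous_norm.rpow_const fun _ => Or.inr hq0.le))
  | ih a =>
    rw [absRpow_coe, traceLq_coe, Completion.norm_coe, div_one]
    change τ (CFC.abs (τ.ofPreLq a) ^ q) = ((τ.lqNorm q (τ.ofPreLq a) ^ q : ℝ) : ℂ)
    rw [τ.lqNorm_rpow hq0, ← τ.eq_re CFC.rpow_nonneg]

/-- Applying the continuous trace to the series gives one direction; absolute convergence gives the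
other. -/
lemma summable_absRpow_iff (q : ℝ) [Fact (1 ≤ q)] {ι : Type*} (x : ι → τ.Lq q) :
    (Summable fun i => τ.absRpow q 1 (x i)) ↔ Summable fun i => ‖x i‖ ^ q := by
  constructor
  · intro h
    have h1 : Summable fun i => τ.traceLq (τ.absRpow q 1 (x i)) :=
      h.map τ.traceLq τ.traceLq.continuous
    simp only [traceLq_absRpow] at h1
    exact Complex.summable_ofReal.mp h1
  · intro h
    refine Summable.of_norm ?_
    simpa only [norm_absRpow, div_one] using h

/-- The 1-norm is additive on positive elements: the triangle inequality is an upper bound, and the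
contractive trace, which takes the value ∑‖x_i‖^q on the sum, is a lower bound. -/
lemma norm_tsum_absRpow (q : ℝ) [Fact (1 ≤ q)] {ι : Type*} (x : ι → τ.Lq q)
    (h : Summable fun i => τ.absRpow q 1 (x i)) :
    ‖∑' i, τ.absRpow q 1 (x i)‖ = ∑' i, ‖x i‖ ^ q := by
  refine le_antisymm ?_ ?_
  · have h1 : Summable fun i => ‖τ.absRpow q 1 (x i)‖ := by
      simpa only [norm_absRpow, div_one] using (τ.summable_absRpow_iff q x).mp h
    simpa only [norm_absRpow, div_one] using norm_tsum_le_tsum_norm h1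
  · have h1 := (h.hasSum.map τ.traceLq τ.traceLq.continuous).tsum_eq
    simp only [Function.comp_def, traceLq_absRpow] at h1
    rw [← Complex.ofReal_tsum] at h1
    have h2 := τ.norm_traceLq_le (∑' i, τ.absRpow q 1 (x i))
    rw [← h1, Complex.norm_real] at h2
    exact (le_abs_self _).trans h2

lemma lqSumNorm_le_of_norm_le (q : ℝ) [hq : Fact (1 ≤ q)] {ι : Type*} {x y : ι → τ.Lq q}
    (h : ∀ i, ‖y i‖ ≤ ‖x i‖) : τ.lqSumNorm q y ≤ τ.lqSumNorm q x := by
  have hq0 : 0 < q := by linarith [hq.out]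
  unfold lqSumNorm
  by_cases hx : Summable fun i => τ.absRpow q 1 (x i)
  · have hle : ∀ i, ‖y i‖ ^ q ≤ ‖x i‖ ^ q := fun i =>
      Real.rpow_le_rpow (norm_nonneg _) (h i) hq0.le
    have hx' := (τ.summable_absRpow_iff q x).mp hx
    have hy' : Summable fun i => ‖y i‖ ^ q :=
      Summable.of_nonneg_of_le (fun i => by positivity) hle hx'
    have hy := (τ.summable_absRpow_iff q y).mpr hy'
    rw [if_pos hx, if_pos hy, enorm_le_iff_norm_le, norm_absRpow, norm_absRpow,
      norm_tsum_absRpow τ q _ hx, norm_tsum_absRpow τ q _ hy]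
    exact Real.rpow_le_rpow (tsum_nonneg fun i => by positivity) (hy'.tsum_le_tsum hle hx')
      (by positivity)
  · rw [if_neg hx]
    exact le_top

lemma norm_extendLq_le {q : ℝ} [Fact (1 ≤ q)] (E : A →ₗ[ℂ] A)
    (hE : ∀ a, τ.lqNorm q (E a) ≤ τ.lqNorm q a) (x : τ.Lq q) :
    ‖τ.extendLq q q E x‖ ≤ ‖x‖ := by
  have hf : τ.LocallyUniformlyContinuousLq q q E := fun ε hε =>
    ⟨1, one_pos, fun b => ⟨ε, hε, fun a a' _ _ h => by
      rw [← map_sub]; exact (hE _).trans_lt h⟩⟩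
  induction x using Completion.induction_on with
  | hp => exact isClosed_le hf.continuous_extendLq.norm continuous_norm
  | ih a =>
    rw [hf.extendLq_coe, Completion.norm_coe, Completion.norm_coe]
    exact hE _

end Extension

/-! ### Contractivity of conditional expectations in the q-norm. -/

section Contraction

variable {A : Type*} [CStarAlgebra A] [PartialOrder A] [StarOrderedRing A]
  (τ : NormalFaithfulTrace A)

lemma cfc_abs_mem {S : StarSubalgebra ℂ A} (hS : IsClosed (S : Set A)) (f : ℝ → ℝ) {a : A}
    (ha : a ∈ S) : cfc f (CFC.abs a) ∈ S := by
  have : IsClosed (S : Set A) := hS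
  have h : CFC.abs a ∈ S := by
    unfold CFC.abs
    rw [CFC.sqrt_eq_real_sqrt _ (star_mul_self_nonneg a)]
    exact cfcₙ_mem (𝕜' := ℂ) _ (mul_mem (star_mem ha) ha)
  exact cfc_mem (𝕜' := ℂ) f h

/-- The element (|z|+ε)^(q-2) z⋆ is a regularized norming functional for `z`; the shift by ε makes
sense of the power also when q < 2. Hölder and ε → 0 give Z ≤ Z^(1-1/q) ‖x‖_q with Z = ‖z‖_q^q, and
one divides unless Z = 0. -/
lemma lqNorm_le_of_trace_eq {q : ℝ} (hq : 1 ≤ q) {x z : A}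
    (h : ∀ ε : ℝ, 0 < ε → τ (shift z ε (q - 2) * star z * z) = τ (shift z ε (q - 2) * star z * x)) :
    τ.lqNorm q z ≤ τ.lqNorm q x := by
  have hq0 : 0 < q := by linarith
  set Z := (τ (CFC.abs z ^ q)).re with hZ
  have hZ0 : 0 ≤ Z := τ.re_nonneg CFC.rpow_nonneg
  have key : Z ≤ Z ^ (1 - 1 / q) * τ.lqNorm q x := by
    have hθ : 0 ≤ 1 - 1 / q := by rw [sub_nonneg, div_le_one hq0]; exact hq
    have hl : Filter.Tendsto (fun ε : ℝ => (τ (shift z ε q)).re -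
        2 * ε * (‖z‖ + 1) ^ (q - 1)) (nhdsWithin 0 (Set.Ioi 0)) (nhds Z) := by
      have h2 : Filter.Tendsto (fun ε : ℝ => 2 * ε * (‖z‖ + 1) ^ (q - 1))
          (nhdsWithin 0 (Set.Ioi 0)) (nhds (2 * 0 * (‖z‖ + 1) ^ (q - 1))) :=
        Filter.Tendsto.mono_left (Continuous.tendsto (by fun_prop) _) nhdsWithin_le_nhds
      simpa using (τ.tendsto_shift hq z).sub h2
    have hr := ((τ.tendsto_shift hq z).rpow_const (p := 1 - 1 / q) (Or.inr hθ)).mul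
      ((τ.tendsto_shift hq x).rpow_const (p := 1 / q) (Or.inr (by positivity)))
    refine le_of_tendsto_of_tendsto hl hr ?_
    filter_upwards [Ioc_mem_nhdsGT (show (0 : ℝ) < 1 by norm_num)] with ε hε
    have h1 := τ.shift_lower hq z hε.1 hε.2
    rw [h ε hε.1] at h1
    exact h1.trans ((Complex.re_le_norm _).trans (τ.shift_holder hq x z hε.1))
  rcases hZ0.eq_or_lt with h | h
  · have : τ.lqNorm q z = 0 := by
      rw [lqNorm, ← hZ, ← h, Real.zero_rpow (by positivity)]
    rw [this]
    exact τ.lqNorm_nonneg q x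
  · have e : Z = Z ^ (1 - 1 / q) * Z ^ (1 / q) := by
      rw [← Real.rpow_add h]; simp
    nth_rw 1 [e] at key
    exact le_of_mul_le_mul_left key (Real.rpow_pos_of_pos h _)

end Contraction

section VonNeumannSubalgebra

variable {H : Type*} [NormedAddCommGroup H] [InnerProductSpace ℂ H] [CompleteSpace H]

/-- The elements of `M` that lie in `N`, as a star subalgebra of `M`. -/
def _root_.VonNeumannAlgebra.starSubalgebraIn (M N : VonNeumannAlgebra H) : StarSubalgebra ℂ M where
  carrier := {x | (x : H →L[ℂ] H) ∈ N}
  mul_mem' hx hy := mul_mem (S := VonNeumannAlgebra H) hx hy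
  one_mem' := one_mem N
  add_mem' hx hy := add_mem (S := VonNeumannAlgebra H) hx hy
  zero_mem' := zero_mem N
  algebraMap_mem' c := N.toStarSubalgebra.algebraMap_mem c
  star_mem' hx := star_mem (S := VonNeumannAlgebra H) hx

lemma _root_.VonNeumannAlgebra.isClosed_starSubalgebraIn (M N : VonNeumannAlgebra H) :
    IsClosed (M.starSubalgebraIn N : Set M) :=
  N.isClosed_coe.preimage continuous_subtype_val

variable {M : VonNeumannAlgebra H} {τ : NormalFaithfulTrace M}

/-- The norming functional `c` of z = E x is built from `z` by functional calculus, so it belongs to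
N, and τ(c E x) = τ(E(cx)) = τ(cx). -/
lemma IsCondExp.lqNorm_le {N : VonNeumannAlgebra H} {E : M →ₗ[ℂ] M} (hE : τ.IsCondExp N E)
    {q : ℝ} (hq : 1 ≤ q) (x : M) : τ.lqNorm q (E x) ≤ τ.lqNorm q x := by
  refine τ.lqNorm_le_of_trace_eq hq fun ε _ => ?_
  have hz : E x ∈ M.starSubalgebraIn N := hE.mem x
  have hc : shift (E x) ε (q - 2) * star (E x) ∈ M.starSubalgebraIn N :=
    mul_mem (cfc_abs_mem (M.isClosed_starSubalgebraIn N) _ hz) (star_mem hz)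
  have h := hE.bimodule _ 1 x hc (one_mem N)
  rw [mul_one, mul_one] at h
  rw [← h, hE.trace]

end VonNeumannSubalgebra

end NormalFaithfulTrace

open scoped ComplexOrder

/-! ### The bounded operator monotone function s ↦ 1 - (1+s)⁻¹. -/

section Resolvent

variable {A : Type*} [CStarAlgebra A] [PartialOrder A] [StarOrderedRing A]

/-- The element `1 - (1 + s)⁻¹`. -/
noncomputable def CFC.oneSubResolvent (s : A) : A := cfc (fun t : ℝ => 1 - (1 + t)⁻¹) s

namespace CFC

lemma continuousOn_inv_one_add {s : A} (hs : 0 ≤ s) :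
    ContinuousOn (fun t : ℝ => (1 + t)⁻¹) (spectrum ℝ s) :=
  ContinuousOn.inv₀ (by fun_prop) fun t ht => by
    have := spectrum_nonneg_of_nonneg hs ht
    positivity

lemma continuousOn_one_sub_inv_one_add {s : A} (hs : 0 ≤ s) :
    ContinuousOn (fun t : ℝ => 1 - (1 + t)⁻¹) (spectrum ℝ s) :=
  continuousOn_const.sub (continuousOn_inv_one_add hs)

lemma oneSubResolvent_nonneg {s : A} (hs : 0 ≤ s) : 0 ≤ oneSubResolvent s :=
  cfc_nonneg fun t ht => by
    have := spectrum_nonneg_of_nonneg hs ht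
    rw [sub_nonneg]
    exact inv_le_one_of_one_le₀ (by linarith)

lemma oneSubResolvent_le_one {s : A} (hs : 0 ≤ s) : oneSubResolvent s ≤ 1 :=
  cfc_le_one _ _ fun t ht => by
    have := spectrum_nonneg_of_nonneg hs ht
    rw [sub_le_self_iff]
    positivity

lemma oneSubResolvent_le_self {s : A} (hs : 0 ≤ s) : oneSubResolvent s ≤ s := by
  nth_rw 2 [← cfc_id' ℝ s]
  refine cfc_mono (fun t ht => ?_) (continuousOn_one_sub_inv_one_add hs) (by fun_prop)
  have := spectrum_nonneg_of_nonneg hs ht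
  have h : 0 < 1 + t := by positivity
  rw [sub_le_iff_le_add, ← sub_le_iff_le_add', inv_eq_one_div, le_div_iff₀ h]
  nlinarith

/-- Operator monotonicity is why this function serves as a smooth substitute for spectral
projections: it turns increasing sums into bounded increasing sequences. -/
lemma oneSubResolvent_mono {s t : A} (hs : 0 ≤ s) (hst : s ≤ t) :
    oneSubResolvent s ≤ oneSubResolvent t := by
  have h := monotoneOn_one_sub_one_add_inv_real (A := A) hs (hs.trans hst) hst
  have key : ∀ {u : A}, 0 ≤ u → cfcₙ (fun x : ℝ => 1 - (1 + x)⁻¹) u = oneSubResolvent u :=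
    fun {u} hu => by
      refine cfcₙ_eq_cfc ?_ (by simp)
      refine continuousOn_const.sub (ContinuousOn.inv₀ (by fun_prop) fun t ht => ?_)
      have := quasispectrum_nonneg_of_nonneg u hu t ht
      positivity
  rwa [key hs, key (hs.trans hst)] at h

/-- With R = (1+s)⁻¹ = 1 - `oneSubResolvent s`, conjugating the hypothesis gives c² R d⋆d R ≤ R s R,
whose right side has norm at most 1. -/
lemma norm_mul_one_sub_oneSubResolvent_le {s d : A} (hs : 0 ≤ s) {c : ℝ} (hc : 0 < c)
    (h : (c ^ 2) • (star d * d) ≤ s) : ‖d * (1 - oneSubResolvent s)‖ ≤ c⁻¹ := by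
  have hsa := hs.isSelfAdjoint
  have hi := continuousOn_inv_one_add hs
  have e : 1 - oneSubResolvent s = cfc (fun t : ℝ => (1 + t)⁻¹) s := by
    rw [oneSubResolvent, ← cfc_const_one ℝ s, ← cfc_sub _ _ _ continuousOn_const
      (continuousOn_one_sub_inv_one_add hs)]
    exact cfc_congr fun t _ => by simp
  set R := cfc (fun t : ℝ => (1 + t)⁻¹) s with hR
  have hRs : star R = R := (cfc_predicate (R := ℝ) _ _ : IsSelfAdjoint R).star_eq
  have h1 : ‖R * s * R‖ ≤ 1 := by
    have : R * s * R = cfc (fun t : ℝ => (1 + t)⁻¹ * t * (1 + t)⁻¹) s := by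
      rw [cfc_mul (fun t : ℝ => (1 + t)⁻¹ * t) _ s (hi.mul continuousOn_id) hi,
        cfc_mul _ (fun t : ℝ => t) s hi continuousOn_id, cfc_id' ℝ s]
    rw [this]
    refine norm_cfc_le zero_le_one fun t ht => ?_
    have := spectrum_nonneg_of_nonneg hs ht
    rw [Real.norm_of_nonneg (by positivity), mul_assoc, inv_mul_le_one₀ (by positivity),
      mul_inv_le_iff₀ (by positivity)]
    nlinarith
  have h2 : (c * ‖d * R‖) ^ 2 ≤ 1 := by
    have h3 : 0 ≤ R * ((c ^ 2) • (star d * d)) * R := by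
      have := star_right_conjugate_nonneg (smul_nonneg (sq_nonneg c) (star_mul_self_nonneg d)) R
      rwa [hRs] at this
    have h4 : R * ((c ^ 2) • (star d * d)) * R ≤ R * s * R := by
      have := star_right_conjugate_le_conjugate h R
      rwa [hRs] at this
    have h5 := CStarAlgebra.norm_le_norm_of_nonneg_of_le h3 h4
    have h6 : R * ((c ^ 2) • (star d * d)) * R = (c ^ 2) • (star (d * R) * (d * R)) := by
      rw [star_mul, hRs, mul_smul_comm, smul_mul_assoc]
      simp only [mul_assoc]
    rw [h6, norm_smul, CStarRing.norm_star_mul_self, Real.norm_of_nonneg (by positivity)] at h5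
    calc _ = c ^ 2 * (‖d * R‖ * ‖d * R‖) := by ring
      _ ≤ 1 := h5.trans h1
  rw [e, ← one_div, le_div_iff₀' hc]
  exact (sq_le_one_iff₀ (by positivity)).mp h2

end CFC

end Resolvent

/-! ### Strong limits of sequences in a von Neumann algebra. -/

namespace VonNeumannAlgebra

open Filter Topology InnerProductSpace

variable {H : Type*} [NormedAddCommGroup H] [InnerProductSpace ℂ H] [CompleteSpace H]

/-- Commutation with each element of the commutant survives strong limits, and `M` is its own
bicommutant. -/
lemma mem_of_tendsto (M : VonNeumannAlgebra H) {T : ℕ → H →L[ℂ] H} {S : H →L[ℂ] H}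
    (hT : ∀ n, T n ∈ M) (h : ∀ ξ, Tendsto (fun n => T n ξ) atTop (𝓝 (S ξ))) : S ∈ M := by
  rw [← SetLike.mem_coe, ← M.centralizer_centralizer]
  intro c hc
  ext ξ
  have h1 : Tendsto (fun n => c (T n ξ)) atTop (𝓝 (c (S ξ))) := (c.continuous.tendsto _).comp (h ξ)
  have h2 : ∀ n, c (T n ξ) = T n (c ξ) := fun n =>
    (DFunLike.congr_fun (hc (T n) (hT n)) ξ).symm
  simp only [h2] at h1
  exact tendsto_nhds_unique h1 (h (c ξ))

lemma exists_tendsto_of_cauchySeq {T : ℕ → H →L[ℂ] H} (h : ∀ ξ, CauchySeq fun n => T n ξ) :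
    ∃ S : H →L[ℂ] H, ∀ ξ, Tendsto (fun n => T n ξ) atTop (𝓝 (S ξ)) := by
  choose f hf using fun ξ => cauchySeq_tendsto_of_complete (h ξ)
  exact ⟨continuousLinearMapOfTendsto T (tendsto_pi_nhds.mpr hf), hf⟩

lemma le_iff_inner {K : Type*} [NormedAddCommGroup K] [InnerProductSpace ℂ K] {S T : K →L[ℂ] K} :
    S ≤ T ↔ ∀ ξ, ⟪S ξ, ξ⟫_ℂ ≤ ⟪T ξ, ξ⟫_ℂ := by
  rw [ContinuousLinearMap.le_def, ContinuousLinearMap.isPositive_iff_complex]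
  refine forall_congr' fun ξ => ?_
  rw [sub_apply, inner_sub_left, ← sub_nonneg (b := ⟪S ξ, ξ⟫_ℂ),
    Complex.nonneg_iff]
  constructor
  · rintro ⟨h1, h2⟩
    refine ⟨h2, ?_⟩
    rw [← h1]; simp
  · rintro ⟨h1, h2⟩
    exact ⟨Complex.ext (by simp) (by simpa using h2), h1⟩

/-- Follows from D² ≤ D. It upgrades convergence of the quadratic forms of a bounded increasing
sequence to strong convergence. -/
lemma norm_apply_sq_le_inner {D : H →L[ℂ] H} (h0 : 0 ≤ D) (h1 : D ≤ 1) (ξ : H) :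
    ‖D ξ‖ ^ 2 ≤ (⟪D ξ, ξ⟫_ℂ).re := by
  have h2 : D ^ 2 ≤ D := by simpa using CStarAlgebra.pow_antitone h0 h1 one_le_two
  have h3 := (Complex.le_def.mp (le_iff_inner.mp h2 ξ)).1
  have h4 : ⟪(D ^ 2) ξ, ξ⟫_ℂ = ⟪D ξ, D ξ⟫_ℂ := by
    rw [sq, mul_apply_eq_comp]
    exact ((ContinuousLinearMap.nonneg_iff_isPositive D).mp h0).inner_left_eq_inner_right (D ξ) ξ
  rw [h4] at h3
  refine le_trans (le_of_eq ?_) h3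
  rw [inner_self_eq_norm_sq_to_K]
  norm_cast

/-- A bounded increasing sequence of a von Neumann algebra converges strongly to its supremum. -/
lemma exists_isLUB_tendsto (M : VonNeumannAlgebra H) {T : ℕ → M} (hT : Monotone T)
    (h0 : ∀ n, 0 ≤ T n) (h1 : ∀ n, T n ≤ 1) :
    ∃ t : M, IsLUB (Set.range T) t ∧
      ∀ ξ, Tendsto (fun n => (T n : H →L[ℂ] H) ξ) atTop (𝓝 ((t : H →L[ℂ] H) ξ)) := by
  have hmono : ∀ ξ, Monotone fun n => (⟪(T n : H →L[ℂ] H) ξ, ξ⟫_ℂ).re := fun ξ m n hmn =>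
    (Complex.le_def.mp (le_iff_inner.mp (hT hmn) ξ)).1
  have hc : ∀ ξ, CauchySeq fun n => (T n : H →L[ℂ] H) ξ := by
    intro ξ
    have hb : BddAbove (Set.range fun n => (⟪(T n : H →L[ℂ] H) ξ, ξ⟫_ℂ).re) := by
      refine ⟨(⟪(1 : H →L[ℂ] H) ξ, ξ⟫_ℂ).re, ?_⟩
      rintro _ ⟨n, rfl⟩
      exact (Complex.le_def.mp (le_iff_inner.mp (h1 n) ξ)).1
    have hcr := (tendsto_atTop_ciSup (hmono ξ) hb).cauchySeq
    rw [Metric.cauchySeq_iff'] at hcr ⊢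
    intro ε hε
    obtain ⟨N, hN⟩ := hcr (ε ^ 2) (by positivity)
    refine ⟨N, fun n hn => ?_⟩
    have hd0 : (0 : H →L[ℂ] H) ≤ (T n : H →L[ℂ] H) - T N := sub_nonneg.mpr (hT hn)
    have hd1 : (T n : H →L[ℂ] H) - T N ≤ 1 :=
      (sub_le_self _ (show (0 : H →L[ℂ] H) ≤ T N from h0 N)).trans (h1 n)
    have h2 := norm_apply_sq_le_inner hd0 hd1 ξ
    rw [sub_apply, inner_sub_left, Complex.sub_re] at h2
    have h3 := hN n hn
    rw [Real.dist_eq] at h3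
    rw [dist_eq_norm]
    exact lt_of_pow_lt_pow_left₀ 2 hε.le (h2.trans_lt ((le_abs_self _).trans_lt h3))
  obtain ⟨S, hS⟩ := exists_tendsto_of_cauchySeq hc
  have hi : ∀ ξ, Tendsto (fun n => ⟪(T n : H →L[ℂ] H) ξ, ξ⟫_ℂ) atTop (𝓝 ⟪S ξ, ξ⟫_ℂ) :=
    fun ξ => (hS ξ).inner tendsto_const_nhds
  refine ⟨⟨S, M.mem_of_tendsto (fun n => (T n).2) hS⟩, ⟨?_, ?_⟩, hS⟩
  · rintro _ ⟨n, rfl⟩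
    change (T n : H →L[ℂ] H) ≤ S
    refine le_iff_inner.mpr fun ξ => ge_of_tendsto (hi ξ) ?_
    filter_upwards [eventually_ge_atTop n] with m hm
    exact le_iff_inner.mp (hT hm) ξ
  · intro u hu
    change S ≤ (u : H →L[ℂ] H)
    refine le_iff_inner.mpr fun ξ => le_of_tendsto (hi ξ) (Eventually.of_forall fun n => ?_)
    exact le_iff_inner.mp (hu ⟨n, rfl⟩) ξ

end VonNeumannAlgebra

open scoped ComplexOrder

namespace NormalFaithfulTrace

/-! ### Approximate 2-norm projections onto a closed star subalgebra. -/

section General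

variable {A : Type*} [CStarAlgebra A] [PartialOrder A] [StarOrderedRing A]
  (τ : NormalFaithfulTrace A)

lemma eq_zero_of_nonneg_of_re_eq_zero {h : A} (hh : 0 ≤ h) (h0 : (τ h).re = 0) : h = 0 := by
  refine τ.eq_zero_of_lqNorm_eq_zero le_rfl ?_
  rw [lqNorm_one_eq, CFC.abs_of_nonneg h hh, h0]

lemma re_mul_le_re_mul {x y h : A} (hxy : x ≤ y) (hh : 0 ≤ h) :
    (τ (x * h)).re ≤ (τ (y * h)).re := by
  have key : ∀ z : A, τ (z * h) = τ (CFC.sqrt h * z * star (CFC.sqrt h)) := fun z => by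
    nth_rw 1 [← CFC.sqrt_mul_sqrt_self h hh]
    rw [(CFC.sqrt_nonneg h).isSelfAdjoint.star_eq, ← mul_assoc, mul_comm_apply, ← mul_assoc]
  rw [key, key]
  exact τ.re_mono (star_right_conjugate_le_conjugate hxy _)

/-- The number `τ(x⋆x) ^ (1 / 2)`. -/
noncomputable def l2Norm (x : A) : ℝ := √(τ (star x * x)).re

lemma l2Norm_nonneg (x : A) : 0 ≤ τ.l2Norm x := Real.sqrt_nonneg _

lemma l2Norm_sq (x : A) : τ.l2Norm x ^ 2 = (τ (star x * x)).re :=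
  Real.sq_sqrt (τ.re_nonneg (star_mul_self_nonneg x))

lemma l2Norm_star (x : A) : τ.l2Norm (star x) = τ.l2Norm x := by
  rw [l2Norm, star_star, mul_comm_apply, l2Norm]

lemma norm_apply_mul_le (x y : A) : ‖τ (x * y)‖ ≤ τ.l2Norm x * τ.l2Norm y := by
  rw [← τ.l2Norm_star x]
  simpa only [l2Norm, star_star] using τ.cauchySchwarz (star x) y

lemma apply_star (x : A) : τ (star x) = star (τ x) := map_star τ.toPositiveLinearMap x

/-- Every element has approximate orthogonal projections onto a subspace. -/
lemma exists_norm_apply_sub_mul_le (S : StarSubalgebra ℂ A) (x : A) {ε : ℝ} (hε : 0 < ε) :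
    ∃ a ∈ S, ∀ b ∈ S, ‖τ ((x - a) * b)‖ ≤ ε * τ.l2Norm b := by
  let i : A →ₗ[ℂ] τ.toPositiveLinearMap.GNS :=
    (UniformSpace.Completion.toComplL (𝕜 := ℂ) (E := τ.toPositiveLinearMap.PreGNS)).toLinearMap ∘ₗ
      τ.toPositiveLinearMap.toPreGNS.toLinearMap
  have hin : ∀ y z : A, inner ℂ (i y) (i z) = τ (star y * z) := fun y z => by
    change inner ℂ ((τ.toPositiveLinearMap.toPreGNS y : τ.toPositiveLinearMap.PreGNS) :
      τ.toPositiveLinearMap.GNS) (τ.toPositiveLinearMap.toPreGNS z : τ.toPositiveLinearMap.PreGNS) = _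
    rw [UniformSpace.Completion.inner_coe, PositiveLinearMap.preGNS_inner_def]
    rfl
  have hno : ∀ y : A, ‖i y‖ = τ.l2Norm y := fun y => by
    rw [@norm_eq_sqrt_re_inner ℂ, hin]; rfl
  let K : Submodule ℂ τ.toPositiveLinearMap.GNS :=
    (S.toSubalgebra.toSubmodule.map i).topologicalClosure
  have hK : IsClosed (K : Set τ.toPositiveLinearMap.GNS) :=
    Submodule.isClosed_topologicalClosure _
  have : CompleteSpace K := hK.completeSpace_coe
  have hv : K.starProjection (i (star x)) ∈ closure (S.toSubalgebra.toSubmodule.map i : Set _) :=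
    Submodule.starProjection_apply_mem K _
  obtain ⟨_, ⟨a, ha, rfl⟩, hav⟩ := Metric.mem_closure_iff.mp hv ε hε
  -- The GNS inner product is τ(y⋆z), conjugate-linear in `y`, so it is `star x` that is projected
  -- and the approximant `a` is starred back.
  refine ⟨star a, star_mem (s := S) ha, fun b hb => ?_⟩
  have hbK : i b ∈ K := Submodule.le_topologicalClosure _ ⟨b, hb, rfl⟩
  have h1 : inner ℂ (i (star x) - K.starProjection (i (star x))) (i b) = 0 :=
    Submodule.starProjection_inner_eq_zero _ _ hbK
  have h2 : τ ((x - star a) * b) = inner ℂ (K.starProjection (i (star x)) - i a) (i b) := by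
    have : x - star a = star (star x - a) := by simp
    rw [this, ← hin, map_sub, ← sub_add_sub_cancel _ (K.starProjection (i (star x))),
      inner_add_left, h1, zero_add]
  rw [h2, ← hno]
  refine (norm_inner_le_norm _ _).trans ?_
  rw [dist_eq_norm] at hav
  gcongr

/-- For self-adjoint `x`, the adjoint of an approximate projection is equally good (test against
b⋆), hence so is the average of the two. -/
lemma exists_isSelfAdjoint_norm_apply_sub_mul_le (S : StarSubalgebra ℂ A) {x : A}
    (hx : IsSelfAdjoint x) {ε : ℝ} (hε : 0 < ε) :
    ∃ a ∈ S, IsSelfAdjoint a ∧ ∀ b ∈ S, ‖τ ((x - a) * b)‖ ≤ ε * τ.l2Norm b := by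
  obtain ⟨a, ha, h⟩ := τ.exists_norm_apply_sub_mul_le S x hε
  refine ⟨(2⁻¹ : ℂ) • (a + star a), S.smul_mem (add_mem ha (star_mem ha)) _, ?_, fun b hb => ?_⟩
  · rw [isSelfAdjoint_iff, star_smul, star_add, star_star, add_comm]
    simp
  have h1 : ‖τ ((x - star a) * b)‖ ≤ ε * τ.l2Norm b := by
    have h2 := h (star b) (star_mem hb)
    rw [l2Norm_star, mul_comm_apply, ← norm_star, ← apply_star, star_mul, star_star, star_sub,
      hx.star_eq] at h2
    exact h2
  have e : (x - (2⁻¹ : ℂ) • (a + star a)) * b =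
      (2⁻¹ : ℂ) • ((x - a) * b) + (2⁻¹ : ℂ) • ((x - star a) * b) := by
    rw [← smul_add, ← add_mul, ← smul_mul_assoc]
    congr 1
    module
  rw [e, map_add, map_smul, map_smul]
  refine (norm_add_le _ _).trans ?_
  rw [norm_smul, norm_smul]
  have : ‖(2⁻¹ : ℂ)‖ = 2⁻¹ := by norm_num
  rw [this]
  linarith [h b hb]

/-- The approximate orthogonal projections of an element between `0` and `1` may be taken bounded
by `1`. -/
lemma exists_norm_le_one_norm_apply_sub_mul_le {S : StarSubalgebra ℂ A}
    (hS : IsClosed (S : Set A)) {x : A} (hx0 : 0 ≤ x) (hx1 : x ≤ 1) {ε : ℝ} (hε : 0 < ε) :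
    ∃ y ∈ S, ‖y‖ ≤ 1 ∧ ∀ b ∈ S, ‖τ ((x - y) * b)‖ ≤ ε * τ.l2Norm b := by
  have : IsClosed (S : Set A) := hS
  obtain ⟨a, ha, hsa, h⟩ := τ.exists_isSelfAdjoint_norm_apply_sub_mul_le S hx0.isSelfAdjoint
    (show 0 < ε / 3 by positivity)
  have hmem : ∀ f : ℝ → ℝ, cfc f a ∈ S := fun f => cfc_mem (𝕜' := ℂ) f ha
  -- `g` and `k` are the excess of `a` above 1 and below 0; a - g(a) + k(a) is its truncation to
  -- [0,1]. Pairing x - a with g(a) gives τ(g(a)²) ≤ |τ((x-a)g(a))|, because x ≤ 1 and a g(a) =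
  -- g(a)² + g(a). Thus g(a) is small in the 2-norm; k(a) is treated likewise using x ≥ 0.
  set g : ℝ → ℝ := fun t => max (t - 1) 0 with hg
  set k : ℝ → ℝ := fun t => max (-t) 0 with hk
  have hgc : Continuous g := by fun_prop
  have hkc : Continuous k := by fun_prop
  have hg0 : 0 ≤ cfc g a := cfc_nonneg fun t _ => le_max_right _ _
  have hk0 : 0 ≤ cfc k a := cfc_nonneg fun t _ => le_max_right _ _
  have key : ∀ b : A, 0 ≤ b → b ∈ S → (τ (b * b)).re ≤ ‖τ ((x - a) * b)‖ → τ.l2Norm b ≤ ε / 3 := by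
    intro b hb hbS hle
    have h1 := hle.trans (h b hbS)
    have h2 := τ.l2Norm_sq b
    rw [hb.isSelfAdjoint.star_eq] at h2
    rw [← h2, sq] at h1
    rcases (τ.l2Norm_nonneg b).eq_or_lt with h0 | h0
    · rw [← h0]; positivity
    · exact le_of_mul_le_mul_right h1 h0
  have hgn : τ.l2Norm (cfc g a) ≤ ε / 3 := by
    refine key _ hg0 (hmem g) ?_
    have h1 : a * cfc g a = cfc g a * cfc g a + cfc g a := by
      rw [← cfc_mul _ _ a, ← cfc_add a (fun t => g t * g t) g]
      nth_rw 1 [← cfc_id' ℝ a]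
      rw [← cfc_mul _ _ a]
      refine cfc_congr fun t _ => ?_
      simp only [hg]
      rcases le_total (t - 1) 0 with ht | ht
      · rw [max_eq_right ht]; ring
      · rw [max_eq_left ht]; ring
    have h2 := τ.re_mul_le_re_mul hx1 hg0
    rw [one_mul] at h2
    have h3 : (τ ((x - a) * cfc g a)).re =
        (τ (x * cfc g a)).re - (τ (cfc g a * cfc g a)).re - (τ (cfc g a)).re := by
      rw [sub_mul, h1, map_sub, map_add, Complex.sub_re, Complex.add_re]; ring
    have h4 := (neg_le_abs _).trans (Complex.abs_re_le_norm (τ ((x - a) * cfc g a)))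
    linarith
  have hkn : τ.l2Norm (cfc k a) ≤ ε / 3 := by
    refine key _ hk0 (hmem k) ?_
    have h1 : a * cfc k a = -(cfc k a * cfc k a) := by
      rw [← cfc_mul _ _ a, ← cfc_neg (fun t => k t * k t) a]
      nth_rw 1 [← cfc_id' ℝ a]
      rw [← cfc_mul _ _ a]
      refine cfc_congr fun t _ => ?_
      simp only [hk]
      rcases le_total (-t) 0 with ht | ht
      · rw [max_eq_right ht]; ring
      · rw [max_eq_left ht]; ring
    have h2 := τ.re_mul_le_re_mul hx0 hk0
    rw [zero_mul, map_zero, Complex.zero_re] at h2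
    have h3 : (τ ((x - a) * cfc k a)).re =
        (τ (x * cfc k a)).re + (τ (cfc k a * cfc k a)).re := by
      rw [sub_mul, h1, map_sub, map_neg, Complex.sub_re, Complex.neg_re]; ring
    have h4 := Complex.re_le_norm (τ ((x - a) * cfc k a))
    linarith
  have hy : cfc (fun t => t - g t + k t) a = a - cfc g a + cfc k a := by
    rw [cfc_add a (fun t => t - g t) k, cfc_sub (fun t => t) g a, cfc_id' ℝ a]
  refine ⟨cfc (fun t => t - g t + k t) a, hmem _, norm_cfc_le zero_le_one fun t _ => ?_,
    fun b hb => ?_⟩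
  · rw [Real.norm_eq_abs, abs_le]
    simp only [hg, hk]
    rcases le_total (t - 1) 0 with ht | ht <;> rcases le_total (-t) 0 with ht' | ht' <;>
      simp only [max_eq_left, max_eq_right, ht, ht'] <;> constructor <;> linarith
  · have e : (x - (a - cfc g a + cfc k a)) * b = (x - a) * b + cfc g a * b - cfc k a * b := by
      noncomm_ring
    rw [hy, e, map_sub, map_add]
    have h1 := h b hb
    have h2 := τ.norm_apply_mul_le (cfc g a) b
    have h3 := τ.norm_apply_mul_le (cfc k a) b
    have h4 := mul_le_mul_of_nonneg_right hgn (τ.l2Norm_nonneg b)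
    have h5 := mul_le_mul_of_nonneg_right hkn (τ.l2Norm_nonneg b)
    have h6 := norm_sub_le (τ ((x - a) * b) + τ (cfc g a * b)) (τ (cfc k a * b))
    have h7 := norm_add_le (τ ((x - a) * b)) (τ (cfc g a * b))
    linarith

end General

end NormalFaithfulTrace

open scoped ComplexOrder

namespace NormalFaithfulTrace

/-! ### 2-norm completeness of the unit ball and existence of the conditional expectation. -/

section CondExp

open Filter Topology

variable {H : Type*} [NormedAddCommGroup H] [InnerProductSpace ℂ H] [CompleteSpace H]
  {M : VonNeumannAlgebra H} (τ : NormalFaithfulTrace M)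

/-- If the differences `d n` are summably small in the 2-norm, there are elements
`t k` of small trace such that `d n (1 - t k)` is small in norm for `n ≥ k`. -/
lemma exists_antitone_norm_mul_one_sub_le {d : ℕ → M} (hd : ∀ n, τ.l2Norm (d n) ≤ (1 / 4) ^ n) :
    ∃ t : ℕ → M, Antitone t ∧ (∀ k, 0 ≤ t k) ∧ (∀ k, t k ≤ 1) ∧
      (∀ k, (τ (t k)).re ≤ 2 * (1 / 2) ^ k) ∧
      ∀ k n, k ≤ n → ‖d n * (1 - t k)‖ ≤ (1 / 2) ^ n := by
  -- The weight 4^n is a compromise: ‖d n‖₂² ≤ 16^(-n) keeps the traces summable, while 4^n d_n⋆d_n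
  -- ≤ s k m makes d_n(1+s k m)⁻¹ of norm at most 2^(-n). Each t k will be the supremum over `m` of
  -- `oneSubResolvent (s k m)`.
  set s : ℕ → ℕ → M := fun k m => ∑ n ∈ Finset.Ico k m, ((2 : ℝ) ^ n) ^ 2 • (star (d n) * d n)
    with hs
  have hterm : ∀ n, 0 ≤ ((2 : ℝ) ^ n) ^ 2 • (star (d n) * d n) := fun n =>
    smul_nonneg (by positivity) (star_mul_self_nonneg _)
  have hsub : ∀ {k m k' m' : ℕ}, k' ≤ k → m ≤ m' → s k m ≤ s k' m' := fun hk hm =>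
    Finset.sum_le_sum_of_subset_of_nonneg (Finset.Ico_subset_Ico hk hm) fun n _ _ => hterm n
  have hs0 : ∀ k m, 0 ≤ s k m := fun k m => Finset.sum_nonneg fun n _ => hterm n
  have hτs : ∀ k m, (τ (s k m)).re ≤ 2 * (1 / 2) ^ k := by
    intro k m
    have h1 : (τ (s k m)).re = ∑ n ∈ Finset.Ico k m, ((2 : ℝ) ^ n) ^ 2 * τ.l2Norm (d n) ^ 2 := by
      simp only [hs, map_sum, Complex.re_sum, re_apply_smul, l2Norm_sq]
    have h2 : ∀ n, ((2 : ℝ) ^ n) ^ 2 * τ.l2Norm (d n) ^ 2 ≤ (1 / 2) ^ n := by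
      intro n
      have h3 := pow_le_pow_left₀ (τ.l2Norm_nonneg (d n)) (hd n) 2
      calc _ ≤ ((2 : ℝ) ^ n) ^ 2 * ((1 / 4) ^ n) ^ 2 := by gcongr
        _ = (1 / 4) ^ n := by
          rw [← mul_pow, ← mul_pow, ← pow_mul, mul_comm n 2, pow_mul]; norm_num
        _ ≤ (1 / 2) ^ n := by gcongr; norm_num
    rw [h1]
    refine (Finset.sum_le_sum fun n _ => h2 n).trans
      ((geom_sum_Ico_le_of_lt_one (by norm_num) (by norm_num)).trans (le_of_eq ?_))
    ring
  set T : ℕ → ℕ → M := fun k m => CFC.oneSubResolvent (s k m) with hT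
  have hT0 : ∀ k m, 0 ≤ T k m := fun k m => CFC.oneSubResolvent_nonneg (hs0 k m)
  have hT1 : ∀ k m, T k m ≤ 1 := fun k m => CFC.oneSubResolvent_le_one (hs0 k m)
  choose t ht htξ using fun k => M.exists_isLUB_tendsto (T := T k)
    (fun m m' h => CFC.oneSubResolvent_mono (hs0 k m) (hsub le_rfl h)) (hT0 k) (hT1 k)
  refine ⟨t, antitone_nat_of_succ_le fun k => ?_, fun k => ?_, fun k => ?_, fun k => ?_,
    fun k n hkn => ?_⟩
  · refine (ht (k + 1)).2 ?_
    rintro _ ⟨m, rfl⟩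
    exact (CFC.oneSubResolvent_mono (hs0 _ m) (hsub (Nat.le_succ k) le_rfl)).trans
      ((ht k).1 ⟨m, rfl⟩)
  · exact (hT0 k 0).trans ((ht k).1 ⟨0, rfl⟩)
  · refine (ht k).2 ?_
    rintro _ ⟨m, rfl⟩
    exact hT1 k m
  -- Normality of the trace enters here: a bound for all the traces τ(T k m) bounds the trace of
  -- their supremum.
  · refine (τ.normal' (Set.range (T k)) (Set.range_nonempty _) ?_ ?_ (t k) (ht k)).2 ?_
    · exact directedOn_range.mpr (Monotone.directed_le fun m m' h =>
        CFC.oneSubResolvent_mono (hs0 k m) (hsub le_rfl h))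
    · rintro _ ⟨m, rfl⟩
      exact hT0 k m
    · rintro _ ⟨_, ⟨m, rfl⟩, rfl⟩
      exact (τ.re_mono (CFC.oneSubResolvent_le_self (hs0 k m))).trans (hτs k m)
  · refine ContinuousLinearMap.opNorm_le_bound _ (by positivity) fun ξ => ?_
    have hlim : Tendsto (fun m => ‖((d n * (1 - T k m) : M) : H →L[ℂ] H) ξ‖) atTop
        (𝓝 ‖((d n * (1 - t k) : M) : H →L[ℂ] H) ξ‖) :=
      (((d n : H →L[ℂ] H).continuous.tendsto _).comp (tendsto_const_nhds.sub (htξ k ξ))).norm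
    refine le_of_tendsto hlim ?_
    filter_upwards [eventually_gt_atTop n] with m hm
    have h1 : ((2 : ℝ) ^ n) ^ 2 • (star (d n) * d n) ≤ s k m :=
      Finset.single_le_sum (f := fun n => ((2 : ℝ) ^ n) ^ 2 • (star (d n) * d n))
        (fun n _ => hterm n) (Finset.mem_Ico.mpr ⟨hkn, hm⟩)
    have h2 := CFC.norm_mul_one_sub_oneSubResolvent_le (hs0 k m) (by positivity) h1
    rw [one_div, inv_pow]
    exact ContinuousLinearMap.le_of_opNorm_le _ h2 ξ

/-- An antitone sequence whose traces tend to `0` tends to `0` strongly. -/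
lemma tendsto_apply_zero_of_antitone {t : ℕ → M} (ht : Antitone t) (h0 : ∀ k, 0 ≤ t k)
    (h1 : ∀ k, t k ≤ 1) (hτ : Tendsto (fun k => (τ (t k)).re) atTop (𝓝 0)) (ξ : H) :
    Tendsto (fun k => (t k : H →L[ℂ] H) ξ) atTop (𝓝 0) := by
  -- Pass to the increasing sequence 1 - t k. Its strong limit `u` is its supremum, and τ(1 - u) ≤
  -- τ(t k) → 0, so faithfulness gives u = 1.
  obtain ⟨u, hu, huξ⟩ := M.exists_isLUB_tendsto (T := fun k => 1 - t k)
    (fun k l h => sub_le_sub_left (ht h) 1) (fun k => sub_nonneg.mpr (h1 k))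
    (fun k => sub_le_self 1 (h0 k))
  have hu1 : 0 ≤ 1 - u := sub_nonneg.mpr (hu.2 (by
    rintro _ ⟨k, rfl⟩
    exact sub_le_self 1 (h0 k)))
  have hu2 : (τ (1 - u)).re ≤ 0 := ge_of_tendsto' hτ fun k => τ.re_mono (by
    rw [sub_le_comm]
    exact hu.1 ⟨k, rfl⟩)
  have hu3 : u = 1 :=
    (sub_eq_zero.mp (τ.eq_zero_of_nonneg_of_re_eq_zero hu1 (hu2.antisymm (τ.re_nonneg hu1)))).symm
  have h2 : Tendsto (fun k => ξ - ((1 - t k : M) : H →L[ℂ] H) ξ) atTop (𝓝 (ξ - ξ)) := by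
    refine tendsto_const_nhds.sub ?_
    have := huξ ξ
    rwa [hu3] at this
  rw [sub_self] at h2
  refine h2.congr fun k => ?_
  change ξ - (ξ - (t k : H →L[ℂ] H) ξ) = _
  abel

/-- The unit ball of a von Neumann algebra is complete for the 2-norm of the trace. -/
lemma exists_tendsto_of_l2Norm_sub_le {y : ℕ → M} (hy : ∀ n, ‖y n‖ ≤ 1)
    (hd : ∀ n, τ.l2Norm (y (n + 1) - y n) ≤ (1 / 4) ^ n) :
    ∃ z : M, (∀ ξ, Tendsto (fun n => (y n : H →L[ℂ] H) ξ) atTop (𝓝 ((z : H →L[ℂ] H) ξ))) ∧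
      ∀ b : M, Tendsto (fun n => τ (y n * b)) atTop (𝓝 (τ (z * b))) := by
  obtain ⟨t, htm, ht0, ht1, htτ, htn⟩ := τ.exists_antitone_norm_mul_one_sub_le hd
  have hhalf : Tendsto (fun n : ℕ => 2 * (1 / 2 : ℝ) ^ n) atTop (𝓝 0) := by
    simpa using (tendsto_pow_atTop_nhds_zero_of_lt_one (r := (1 / 2 : ℝ)) (by norm_num)
      (by norm_num)).const_mul 2
  have htξ := τ.tendsto_apply_zero_of_antitone htm ht0 ht1
    (squeeze_zero (fun k => τ.re_nonneg (ht0 k)) htτ hhalf)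
  have hdiff : ∀ k l n, k ≤ l → l ≤ n → ‖(y n - y l) * (1 - t k)‖ ≤ 2 * (1 / 2) ^ l := by
    intro k l n hkl hln
    rw [← Finset.sum_Ico_sub y hln, Finset.sum_mul]
    refine (norm_sum_le_of_le _ fun i hi => htn k i (hkl.trans (Finset.mem_Ico.mp hi).1)).trans
      ((geom_sum_Ico_le_of_lt_one (by norm_num) (by norm_num)).trans (le_of_eq ?_))
    ring
  have hbound : ∀ n l, ‖y n - y l‖ ≤ 2 := fun n l => (norm_sub_le _ _).trans (by linarith [hy n, hy l])
  have hc : ∀ ξ, CauchySeq fun n => (y n : H →L[ℂ] H) ξ := by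
    intro ξ
    rw [Metric.cauchySeq_iff']
    intro ε hε
    have h1 : Tendsto (fun k => 2 * ‖(t k : H →L[ℂ] H) ξ‖) atTop (𝓝 0) := by
      simpa using (htξ ξ).norm.const_mul 2
    have h2 : Tendsto (fun n : ℕ => 2 * (1 / 2 : ℝ) ^ n * ‖ξ‖) atTop (𝓝 0) := by
      simpa using hhalf.mul_const ‖ξ‖
    obtain ⟨k, hk⟩ := (h1.eventually_lt_const (half_pos hε)).exists
    obtain ⟨l, hl, hkl⟩ := ((h2.eventually_lt_const (half_pos hε)).and
      (eventually_ge_atTop k)).exists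
    refine ⟨l, fun n hn => ?_⟩
    -- Split ξ = (1 - t_k)ξ + t_kξ. On the first part the differences are small in norm; on the
    -- second they are bounded by 2 and t_kξ is already small.
    have e : (y n : H →L[ℂ] H) ξ - (y l : H →L[ℂ] H) ξ =
        (((y n - y l) * (1 - t k) : M) : H →L[ℂ] H) ξ +
          ((y n - y l : M) : H →L[ℂ] H) ((t k : H →L[ℂ] H) ξ) := by
      change _ = ((y n - y l : M) : H →L[ℂ] H) (ξ - (t k : H →L[ℂ] H) ξ) + _
      rw [map_sub, sub_add_cancel]
      rfl
    rw [dist_eq_norm, e]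
    have h3 := ContinuousLinearMap.le_of_opNorm_le _ (hdiff k l n hkl hn) ξ
    have h4 := ContinuousLinearMap.le_of_opNorm_le _ (hbound n l) ((t k : H →L[ℂ] H) ξ)
    exact (norm_add_le_of_le h3 h4).trans_lt (by linarith)
  obtain ⟨S, hS⟩ := VonNeumannAlgebra.exists_tendsto_of_cauchySeq hc
  let z : M := ⟨S, M.mem_of_tendsto (fun n => (y n).2) hS⟩
  have hz : ∀ ξ, Tendsto (fun n => (y n : H →L[ℂ] H) ξ) atTop (𝓝 ((z : H →L[ℂ] H) ξ)) := hS
  refine ⟨z, hz, fun b => ?_⟩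
  have hzn : ∀ l, ‖z - y l‖ ≤ 2 := fun l =>
    ContinuousLinearMap.opNorm_le_bound _ zero_le_two fun ξ =>
      le_of_tendsto ((hz ξ).sub_const ((y l : H →L[ℂ] H) ξ)).norm (Eventually.of_forall fun n =>
        ContinuousLinearMap.le_of_opNorm_le _ (hbound n l) ξ)
  have hzt : ∀ l, ‖(z - y l) * (1 - t l)‖ ≤ 2 * (1 / 2) ^ l := fun l =>
    ContinuousLinearMap.opNorm_le_bound _ (by positivity) fun ξ => by
      refine le_of_tendsto ((hz (((1 - t l : M) : H →L[ℂ] H) ξ)).sub_const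
        ((y l : H →L[ℂ] H) (((1 - t l : M) : H →L[ℂ] H) ξ))).norm ?_
      filter_upwards [eventually_ge_atTop l] with n hn
      exact ContinuousLinearMap.le_of_opNorm_le _ (hdiff l l n le_rfl hn) ξ
  rw [tendsto_iff_norm_sub_tendsto_zero]
  refine squeeze_zero (g := fun n => 3 * ‖b‖ * (2 * (1 / 2 : ℝ) ^ n)) (fun n => norm_nonneg _)
    (fun n => ?_) (by simpa using hhalf.const_mul (3 * ‖b‖))
  -- The same splitting under the trace: the part with 1 - t_n is small in operator norm, and the
  -- part with t_n is at most τ(t_n) times a bounded norm.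
  have e : τ (z * b) - τ (y n * b) =
      τ (b * ((z - y n) * (1 - t n))) + τ (t n * (b * (z - y n))) := by
    rw [← map_sub, ← sub_mul, mul_comm_apply, τ.mul_comm_apply (t n), ← map_add]
    congr 1
    noncomm_ring
  rw [norm_sub_rev, e]
  have h1 := (τ.norm_apply_le _).trans (norm_mul_le_of_le (le_refl ‖b‖) (hzt n))
  have h2 := τ.norm_mul_le (ht0 n) (b * (z - y n))
  have h3 := norm_mul_le_of_le (le_refl ‖b‖) (hzn n)
  have h4 := mul_le_mul (htτ n) h3 (norm_nonneg _) (by positivity)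
  refine (norm_add_le _ _).trans ?_
  linarith

/-- Two approximate projections differ by an element d of N, and testing against d⋆ shows that d is
small in the 2-norm. With errors 4^(-n)/2 consecutive ones differ by at most 4^(-n), so completeness
of the unit ball provides the exact projection. -/
lemma exists_mem_apply_mul_eq_of_le_one (N : VonNeumannAlgebra H) {x : M} (hx0 : 0 ≤ x)
    (hx1 : x ≤ 1) : ∃ z ∈ M.starSubalgebraIn N, ∀ b ∈ M.starSubalgebraIn N,
      τ (z * b) = τ (x * b) := by
  have hpos : ∀ n : ℕ, (0 : ℝ) < (1 / 4) ^ n / 2 := fun n => by positivity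
  choose y hyN hy1 hy using fun n : ℕ =>
    τ.exists_norm_le_one_norm_apply_sub_mul_le (M.isClosed_starSubalgebraIn N) hx0 hx1 (hpos n)
  have hd : ∀ n, τ.l2Norm (y (n + 1) - y n) ≤ (1 / 4) ^ n := by
    intro n
    set d := y (n + 1) - y n with hd
    have hdN : star d ∈ M.starSubalgebraIn N := star_mem (sub_mem (hyN _) (hyN _))
    have h1 : τ.l2Norm d ^ 2 ≤ (1 / 4) ^ n * τ.l2Norm d := by
      have e : τ (star d * d) = τ ((x - y n) * star d) - τ ((x - y (n + 1)) * star d) := by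
        rw [mul_comm_apply, ← map_sub, ← sub_mul, sub_sub_sub_cancel_left]
      rw [l2Norm_sq, e]
      have h2 := hy n _ hdN
      have h3 := hy (n + 1) _ hdN
      rw [l2Norm_star] at h2 h3
      have h4 : (1 / 4 : ℝ) ^ (n + 1) / 2 * τ.l2Norm d ≤ (1 / 4) ^ n / 2 * τ.l2Norm d := by
        have := τ.l2Norm_nonneg d
        gcongr ?_ / 2 * _
        exact pow_le_pow_of_le_one (by norm_num) (by norm_num) (Nat.le_succ n)
      have h5 := (Complex.re_le_norm _).trans
        (norm_sub_le (τ ((x - y n) * star d)) (τ ((x - y (n + 1)) * star d)))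
      linarith
    rcases (τ.l2Norm_nonneg d).eq_or_lt with h0 | h0
    · rw [← h0]; positivity
    · rw [sq] at h1
      exact le_of_mul_le_mul_right h1 h0
  obtain ⟨z, hz, hzb⟩ := τ.exists_tendsto_of_l2Norm_sub_le hy1 hd
  refine ⟨z, N.mem_of_tendsto hyN hz, fun b hb => ?_⟩
  refine tendsto_nhds_unique (hzb b) ?_
  rw [tendsto_iff_norm_sub_tendsto_zero]
  refine squeeze_zero (g := fun n => (1 / 4 : ℝ) ^ n / 2 * τ.l2Norm b) (fun n => norm_nonneg _)
    (fun n => ?_) ?_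
  · rw [norm_sub_rev, ← map_sub, ← sub_mul]
    exact hy n b hb
  · have := ((tendsto_pow_atTop_nhds_zero_of_lt_one (r := (1 / 4 : ℝ)) (by norm_num)
      (by norm_num)).div_const 2).mul_const (τ.l2Norm b)
    simpa using this

lemma exists_mem_apply_mul_eq (N : VonNeumannAlgebra H) (x : M) :
    ∃ z ∈ M.starSubalgebraIn N, ∀ b ∈ M.starSubalgebraIn N, τ (z * b) = τ (x * b) := by
  -- Positive elements span, and a positive element becomes at most 1 after division by ‖x‖ + 1.
  have hx : x ∈ Submodule.span ℂ {a : M | 0 ≤ a} := by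
    rw [CStarAlgebra.span_nonneg]; trivial
  induction hx using Submodule.span_induction with
  | mem x hx =>
    have hx : 0 ≤ x := hx
    have h0 : 0 < ‖x‖ + 1 := by positivity
    have h1 : (‖x‖ + 1)⁻¹ • x ≤ 1 := by
      rw [← CStarAlgebra.norm_le_one_iff_of_nonneg _ (smul_nonneg (by positivity) hx), norm_smul,
        Real.norm_of_nonneg (by positivity), inv_mul_le_one₀ h0]
      linarith
    obtain ⟨z, hz, h⟩ := τ.exists_mem_apply_mul_eq_of_le_one N
      (smul_nonneg (show 0 ≤ (‖x‖ + 1)⁻¹ by positivity) hx) h1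
    refine ⟨((‖x‖ + 1 : ℝ) : ℂ) • z, (M.starSubalgebraIn N).smul_mem hz _, fun b hb => ?_⟩
    rw [smul_mul_assoc, map_smul, h b hb, ← map_smul, ← smul_mul_assoc, Complex.coe_smul,
      smul_inv_smul₀ h0.ne']
  | zero => exact ⟨0, zero_mem _, fun b _ => rfl⟩
  | add x y _ _ hx hy =>
    obtain ⟨z, hz, h⟩ := hx
    obtain ⟨w, hw, h'⟩ := hy
    exact ⟨z + w, add_mem hz hw, fun b hb => by
      rw [add_mul, add_mul, map_add, map_add, h b hb, h' b hb]⟩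
  | smul c x _ hx =>
    obtain ⟨z, hz, h⟩ := hx
    exact ⟨c • z, (M.starSubalgebraIn N).smul_mem hz c, fun b hb => by
      rw [smul_mul_assoc, smul_mul_assoc, map_smul, map_smul, h b hb]⟩

lemma eq_of_apply_mul_eq {S : StarSubalgebra ℂ M} {y z : M} (hy : y ∈ S) (hz : z ∈ S)
    (h : ∀ b ∈ S, τ (y * b) = τ (z * b)) : y = z := by
  have h1 := h (star (y - z)) (star_mem (sub_mem hy hz))
  rw [← sub_eq_zero, ← map_sub, ← sub_mul, mul_comm_apply] at h1
  exact sub_eq_zero.mp (τ.faithful' _ h1)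

/-- The trace-preserving conditional expectation onto a von Neumann subalgebra exists. -/
theorem exists_isCondExp (N : VonNeumannAlgebra H) :
    ∃ E : M →ₗ[ℂ] M, τ.IsCondExp N E := by
  -- By faithfulness an element of N is determined by its trace pairings with N, so linearity and
  -- the bimodule property are checked by pairing both sides; pairing with 1 gives trace
  -- preservation.
  choose E hE h using τ.exists_mem_apply_mul_eq N
  refine ⟨⟨⟨E, fun x y => ?_⟩, fun c x => ?_⟩, hE, fun a b x ha hb => ?_, fun x => ?_⟩
  · refine τ.eq_of_apply_mul_eq (hE _) (add_mem (hE x) (hE y)) fun b hb => ?_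
    rw [h _ b hb, add_mul, add_mul, map_add, map_add, h x b hb, h y b hb]
  · refine τ.eq_of_apply_mul_eq (hE _) ((M.starSubalgebraIn N).smul_mem (hE x) c) fun b hb => ?_
    simp only [RingHom.id_apply]
    rw [h _ b hb, smul_mul_assoc, smul_mul_assoc, map_smul, map_smul, h x b hb]
  · have ha : a ∈ M.starSubalgebraIn N := ha
    have hb : b ∈ M.starSubalgebraIn N := hb
    refine τ.eq_of_apply_mul_eq (hE _) (mul_mem (mul_mem ha (hE x)) hb) fun c hc => ?_
    change τ (E (a * x * b) * c) = τ (a * E x * b * c)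
    have e : ∀ w : M, τ (a * w * b * c) = τ (w * (b * c * a)) := fun w => by
      rw [mul_assoc, mul_assoc, mul_comm_apply]
      simp only [mul_assoc]
    rw [h _ c hc, e, e, h x _ (mul_mem (mul_mem hb hc) ha)]
  · have := h x 1 (one_mem _)
    rwa [mul_one, mul_one] at this

/-- Existence excludes the default value 0 in the definition of `condExp`. -/
lemma isCondExp_condExp (N : VonNeumannAlgebra H) :
    τ.IsCondExp N (τ.condExp N) := by
  have h := τ.exists_isCondExp N
  rw [condExp, dif_pos h]
  exact h.choose_spec

end CondExp

end NormalFaithfulTrace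

theorem proposition2p10 {H : Type*} [NormedAddCommGroup H] [InnerProductSpace ℂ H] [CompleteSpace H]
    (M : VonNeumannAlgebra H) (τ : NormalFaithfulTrace M)
    (N : ℕ → VonNeumannAlgebra H) (hmono : Monotone N) (hle : ∀ n, N n ≤ M)
    (q : ℝ) [Fact (1 ≤ q)] (x : ℕ+ → τ.Lq q) :
    τ.lqSumNorm q (fun n : ℕ+ => τ.condExpLq (N ((n : ℕ) - 1)) q (x n)) ≤ τ.lqSumNorm q x :=
  τ.lqSumNorm_le_of_norm_le q fun n => τ.norm_extendLq_le _
    (fun a => (τ.isCondExp_condExp _).lqNorm_le Fact.out a) (x n)
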